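/- There are computable functions $f\colon\mathbb{N}^3\to\mathbb{N}$ and $g\colon\mathbb{N}\to\mathbb{N}$ with the following property. Let $q,d,t\in\mathbb{N}$, let $\varphi(\bar x,\bar y)$ be a first-order formula in the language of graphs (adjacency and equality) of quantifier rank at most $q$, whose $d=|\bar x|+|\bar y|$ free variables are split into two tuples $\bar x$ and $\bar y$, and let $G$ be a finite simple undirected graph that does not contain the complete graph $K_t$ as a depth-$g(q)$ minor. Then the ladder index of $\varphi(\bar x,\bar y)$ in $G$ is at most $f(q,d,t)$. Here $H$ is a depth-$r$ minor of $G$ if there are pairwise vertex-disjoint connected subgraphs $(I_u)_{u\in V(H)}$ of $G$, each of radius at most $r$, such that for every edge $uv$ of $H$ some vertex of $I_u$ is adjacent in $G$ to some vertex of $I_v$. A $\varphi$-ladder of length $n$ in $G$ is a sequence of tuples $\bar u_1,\dots,\bar u_n\in V(G)^{|\bar x|}$, $\bar v_1,\dots,\bar v_n\in V(G)^{|\bar y|}$ such that, for all $1\le i,j\le n$, $G\models\varphi(\bar u_i,\bar v_j)$ if and only if $i\le j$. The ladder index of $\varphi(\bar x,\bar y)$ in $G$ is the least $n$ for which there is no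 $\varphi$-ladder of length $n$ in $G$. -/

import Mathlib

open FirstOrder

namespace FirstOrder.Language.BoundedFormula

/-- The quantifier rank: the maximal nesting depth of quantifiers. The primitive quantifier is `∀`;
`∃` is `¬∀¬`, and connectives do not change the rank. -/
def quantifierRank {L : Language} {α : Type*} : {n : ℕ} → L.BoundedFormula α n → ℕ
  | _, falsum => 0
  | _, equal _ _ => 0
  | _, rel _ _ => 0
  | _, imp φ ψ => max φ.quantifierRank ψ.quantifierRank
  | _, all φ => φ.quantifierRank + 1

end FirstOrder.Language.BoundedFormula

namespace FirstOrder.Language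

/-- The tuples `u 0, …, u (n-1)` and `v 0, …, v (n-1)` form a `φ`-ladder of length `n` in the
structure `M`, where the free variables of `φ` are split into a left and a right tuple. -/
def IsLadder {L : Language} {M : Type*} [L.Structure M] {a b : ℕ}
    (φ : L.Formula (Fin a ⊕ Fin b)) {n : ℕ}
    (u : Fin n → Fin a → M) (v : Fin n → Fin b → M) : Prop :=
  ∀ i j : Fin n, φ.Realize (Sum.elim (u i) (v j)) ↔ i ≤ j

/-- The ladder index of `φ` in `M`: the least `n` for which there is no `φ`-ladder of length `n`
in `M`, and `⊤` if there is no such `n`. -/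
noncomputable def ladderIndex {L : Language} (M : Type*) [L.Structure M] {a b : ℕ}
    (φ : L.Formula (Fin a ⊕ Fin b)) : ℕ∞ :=
  sInf {m : ℕ∞ | ∃ n : ℕ, m = n ∧
    ¬ ∃ (u : Fin n → Fin a → M) (v : Fin n → Fin b → M), IsLadder φ u v}

end FirstOrder.Language

namespace SimpleGraph

/-- `I` is a minor model of `H` in `G`: a family of pairwise vertex-disjoint connected subgraphs
(branch sets) of `G`, such that adjacent vertices of `H` have branch sets joined by an edge. -/
structure IsMinorModel {W V : Type*} (H : SimpleGraph W) (G : SimpleGraph V)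
    (I : W → G.Subgraph) : Prop where
  connected : ∀ w, (I w).Connected
  disjoint : ∀ w w', w ≠ w' → Disjoint (I w).verts (I w').verts
  edge : ∀ w w', H.Adj w w' → ∃ x ∈ (I w).verts, ∃ y ∈ (I w').verts, G.Adj x y

/-- `H` is a depth-`r` minor of `G`: there is a minor model all of whose branch sets, as graphs
on their own, have radius at most `r`. -/
def IsDepthMinor {W V : Type*} (H : SimpleGraph W) (r : ℕ) (G : SimpleGraph V) : Prop :=
  ∃ I : W → G.Subgraph, IsMinorModel H G I ∧ ∀ w, (I w).coe.radius ≤ r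

end SimpleGraph

/-! A long ladder contains two rungs i < j whose right tuples can be exchanged without φ noticing,
although φ(u_i, v_j) holds and φ(u_j, v_i) fails.

The exchange works when both rungs have the same game type of high rank over a small set S and are
far from each other in G - S. The equality of types read forwards matches u_i with u_j, and read
backwards it matches v_j with v_i. These are two good positions, mutually far off S on both sides,
and `IsSplitPosition.backForth_iUnion` lets Duplicator win q rounds on their union. The required
distance drops by a factor 4 in each round. A move near some part is answered inside that part. A
move far from all parts needs a far answer of the same type over S. It exists by counting
(`IsSplitPosition.exists_far`): both sides of the game are the same graph, so scattered sets of one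
type near the two sides of a position can be compared.

Uniform quasi-wideness (`exists_scattered_tuples`) supplies S and many mutually far rungs. Disjoint
balls are grown radius by radius; each step (`exists_disjoint_balls_succ`) deletes at most t
vertices or exposes a shallow K_t minor, by the bipartite dichotomy `exists_sparse_or_hasStarModel`.
The number of types is bounded independently of G, so two of these rungs share a type. All bounds
are iterates of elementary arithmetic, hence primitive recursive. -/

namespace SimpleGraph

/-! ### Bounded walks that avoid a set -/

variable {V : Type*} (G : SimpleGraph V)

/-- `y` can be reached from `x` by at most `k` steps along edges of `G`, without leaving `U`.
In particular both `x` and `y` lie in `U`. -/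
def Near (U : Set V) : ℕ → V → V → Prop
  | 0, x, y => x = y ∧ x ∈ U
  | k + 1, x, y => ∃ z, Near U k x z ∧ y ∈ U ∧ (z = y ∨ G.Adj z y)

variable {G}

namespace Near

variable {U U' : Set V} {k l : ℕ} {x y z : V}

theorem left_mem (h : G.Near U k x y) : x ∈ U := by
  induction k generalizing y with
  | zero => exact h.2
  | succ k ih => obtain ⟨z, hz, -⟩ := h; exact ih hz

theorem right_mem (h : G.Near U k x y) : y ∈ U := by
  cases k with
  | zero => exact h.1 ▸ h.2
  | succ k => obtain ⟨z, -, hy, -⟩ := h; exact hy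

theorem succ (h : G.Near U k x y) : G.Near U (k + 1) x y :=
  ⟨y, h, h.right_mem, Or.inl rfl⟩

theorem mono_le (h : G.Near U k x y) (hkl : k ≤ l) : G.Near U l x y := by
  induction hkl with
  | refl => exact h
  | step _ ih => exact ih.succ

theorem mono_set (hU : U ⊆ U') (h : G.Near U k x y) : G.Near U' k x y := by
  induction k generalizing y with
  | zero => exact ⟨h.1, hU h.2⟩
  | succ k ih => obtain ⟨z, hz, hy, h⟩ := h; exact ⟨z, ih hz, hU hy, h⟩

theorem refl (hx : x ∈ U) : G.Near U k x x :=
  mono_le (k := 0) ⟨rfl, hx⟩ k.zero_le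

theorem of_adj (hx : x ∈ U) (hy : y ∈ U) (h : G.Adj x y) : G.Near U 1 x y :=
  ⟨x, ⟨rfl, hx⟩, hy, Or.inr h⟩

theorem trans (h : G.Near U k x y) (h' : G.Near U l y z) : G.Near U (k + l) x z := by
  induction l generalizing z with
  | zero => exact h'.1 ▸ h
  | succ l ih => obtain ⟨w, hw, hz, h'⟩ := h'; exact ⟨w, ih hw, hz, h'⟩

theorem symm (h : G.Near U k x y) : G.Near U k y x := by
  induction k generalizing y with
  | zero => exact ⟨h.1.symm, h.1 ▸ h.2⟩
  | succ k ih =>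
    obtain ⟨z, hz, hy, h⟩ := h
    have h1 : G.Near U 1 y z := ⟨y, ⟨rfl, hy⟩, hz.right_mem, h.imp Eq.symm Adj.symm⟩
    exact (h1.trans (ih hz)).mono_le (by omega)

theorem exists_of_add (h : G.Near U (k + l) x y) : ∃ z, G.Near U k x z ∧ G.Near U l z y := by
  induction l generalizing y with
  | zero => exact ⟨y, h, rfl, h.right_mem⟩
  | succ l ih =>
    obtain ⟨w, hw, hy, h⟩ := h
    obtain ⟨z, hz, hzw⟩ := ih hw
    exact ⟨z, hz, w, hzw, hy, h⟩

end Near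

/-! ### Ehrenfeucht–Fraïssé games of a graph with itself -/

variable (G)

/-- The pairs in `L` form a partial isomorphism of `G` with itself. -/
def IsPartialIso (L : Set (V × V)) : Prop :=
  ∀ e ∈ L, ∀ f ∈ L, (e.1 = f.1 ↔ e.2 = f.2) ∧ (G.Adj e.1 f.1 ↔ G.Adj e.2 f.2)

/-- Duplicator wins the Ehrenfeucht–Fraïssé game of `p` rounds between `G` and itself that starts
from the position `L`. -/
def BackForth : ℕ → Set (V × V) → Prop
  | 0, L => G.IsPartialIso L
  | p + 1, L => G.IsPartialIso L ∧ (∀ x, ∃ y, BackForth p (insert (x, y) L)) ∧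
      ∀ y, ∃ x, BackForth p (insert (x, y) L)

variable {G}

theorem IsPartialIso.mono {L M : Set (V × V)} (h : G.IsPartialIso M) (hLM : L ⊆ M) :
    G.IsPartialIso L :=
  fun e he e' he' => h e (hLM he) e' (hLM he')

theorem IsPartialIso.swap {L : Set (V × V)} (h : G.IsPartialIso L) :
    G.IsPartialIso (Prod.swap ⁻¹' L) :=
  fun _ he _ he' => ⟨(h _ he _ he').1.symm, (h _ he _ he').2.symm⟩

namespace BackForth

variable {p : ℕ} {L M : Set (V × V)} {x y : V}

theorem isPartialIso (h : G.BackForth p L) : G.IsPartialIso L := by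
  cases p with
  | zero => exact h
  | succ p => exact h.1

theorem mono (h : G.BackForth p M) (hLM : L ⊆ M) : G.BackForth p L := by
  induction p generalizing L M with
  | zero => exact h.isPartialIso.mono hLM
  | succ p ih =>
    refine ⟨h.1.mono hLM, fun x => ?_, fun y => ?_⟩
    · obtain ⟨y, hy⟩ := h.2.1 x
      exact ⟨y, ih hy (Set.insert_subset_insert hLM)⟩
    · obtain ⟨x, hx⟩ := h.2.2 y
      exact ⟨x, ih hx (Set.insert_subset_insert hLM)⟩

theorem of_succ (h : G.BackForth (p + 1) L) : G.BackForth p L := by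
  induction p generalizing L with
  | zero => exact h.1
  | succ p ih =>
    refine ⟨h.1, fun x => ?_, fun y => ?_⟩
    · obtain ⟨y, hy⟩ := h.2.1 x
      exact ⟨y, ih hy⟩
    · obtain ⟨x, hx⟩ := h.2.2 y
      exact ⟨x, ih hx⟩

theorem mono_le {p' : ℕ} (h : G.BackForth p' L) (hp : p ≤ p') : G.BackForth p L := by
  induction hp with
  | refl => exact h
  | step _ ih => exact ih h.of_succ

theorem swap (h : G.BackForth p L) : G.BackForth p (Prod.swap ⁻¹' L) := by
  induction p generalizing L with
  | zero => exact h.isPartialIso.swap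
  | succ p ih =>
    have key : ∀ x y, Prod.swap ⁻¹' insert (x, y) L = insert (y, x) (Prod.swap ⁻¹' L) := by
      intro x y; ext ⟨a, b⟩; simp [and_comm]
    refine ⟨h.1.swap, fun x => ?_, fun y => ?_⟩
    · obtain ⟨y, hy⟩ := h.2.2 x
      exact ⟨y, key y x ▸ ih hy⟩
    · obtain ⟨x, hx⟩ := h.2.1 y
      exact ⟨x, key y x ▸ ih hx⟩

theorem of_diagonal (h : ∀ e ∈ L, e.1 = e.2) : G.BackForth p L := by
  have h0 : ∀ L : Set (V × V), (∀ e ∈ L, e.1 = e.2) → G.IsPartialIso L := fun L h e he e' he' => by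
    rw [h e he, h e' he']; simp
  have h1 : ∀ L : Set (V × V), (∀ e ∈ L, e.1 = e.2) → ∀ x, ∀ e ∈ insert (x, x) L, e.1 = e.2 := by
    rintro L h x e (rfl | he)
    · rfl
    · exact h e he
  induction p generalizing L with
  | zero => exact h0 L h
  | succ p ih => exact ⟨h0 L h, fun x => ⟨x, ih (h1 L h x)⟩, fun x => ⟨x, ih (h1 L h x)⟩⟩

/-- Duplicator answers in the first game and feeds that answer to the second as Spoiler's move. -/
theorem comp (hL : G.BackForth p L) (hM : G.BackForth p M) :
    G.BackForth p {e | ∃ y, (e.1, y) ∈ L ∧ (y, e.2) ∈ M} := by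
  have h0 : ∀ L M : Set (V × V), G.IsPartialIso L → G.IsPartialIso M →
      G.IsPartialIso {e | ∃ y, (e.1, y) ∈ L ∧ (y, e.2) ∈ M} := by
    rintro L M hL hM e ⟨y, h1, h2⟩ e' ⟨y', h1', h2'⟩
    exact ⟨(hL _ h1 _ h1').1.trans (hM _ h2 _ h2').1, (hL _ h1 _ h1').2.trans (hM _ h2 _ h2').2⟩
  have h1 : ∀ (L M : Set (V × V)) (x y z : V),
      insert (x, z) {e : V × V | ∃ y, (e.1, y) ∈ L ∧ (y, e.2) ∈ M} ⊆
        {e | ∃ w, (e.1, w) ∈ insert (x, y) L ∧ (w, e.2) ∈ insert (y, z) M} := by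
    rintro L M x y z e (rfl | ⟨w, hw, hw'⟩)
    · exact ⟨y, Set.mem_insert _ _, Set.mem_insert _ _⟩
    · exact ⟨w, Set.mem_insert_of_mem _ hw, Set.mem_insert_of_mem _ hw'⟩
  induction p generalizing L M with
  | zero => exact h0 L M hL hM
  | succ p ih =>
    refine ⟨h0 L M hL.1 hM.1, fun x => ?_, fun z => ?_⟩
    · obtain ⟨y, hy⟩ := hL.2.1 x
      obtain ⟨z, hz⟩ := hM.2.1 y
      exact ⟨z, (ih hy hz).mono (h1 L M x y z)⟩
    · obtain ⟨y, hy⟩ := hM.2.2 z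
      obtain ⟨x, hx⟩ := hL.2.2 y
      exact ⟨x, (ih hx hy).mono (h1 L M x y z)⟩

theorem mem_iff {S : Set V} (h : G.BackForth p L) (hS : ∀ s ∈ S, (s, s) ∈ L)
    (hx : (x, y) ∈ L) : x ∈ S ↔ y ∈ S := by
  constructor
  · intro hxS
    have := (h.isPartialIso _ hx _ (hS x hxS)).1.1 rfl
    simp only at this
    rwa [this]
  · intro hyS
    have := (h.isPartialIso _ hx _ (hS y hyS)).1.2 rfl
    simp only at this
    rwa [this]

/-- If Spoiler plays the vertices of a walk one by one from its end, Duplicator's answers trace a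
walk on the other side. It avoids `S` too, since the diagonal pairs force `S` to be preserved. -/
theorem near {S : Set V} (h : G.BackForth p L) (hS : ∀ s ∈ S, (s, s) ∈ L) {k : ℕ} (hk : k ≤ p)
    {e e' : V × V} (he : e ∈ L) (he' : e' ∈ L) (hn : G.Near Sᶜ k e.1 e'.1) :
    G.Near Sᶜ k e.2 e'.2 := by
  induction k generalizing p L e' with
  | zero =>
    exact ⟨(h.isPartialIso _ he _ he').1.1 hn.1, fun hx => hn.2 ((h.mem_iff hS he).2 hx)⟩
  | succ k ih =>
    obtain ⟨p, rfl⟩ : ∃ p', p = p' + 1 := ⟨p - 1, by omega⟩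
    obtain ⟨z, hz, hy, hzy⟩ := hn
    obtain ⟨w, hw⟩ := h.2.1 z
    have hzw := hw.isPartialIso (z, w) (Set.mem_insert _ _) e' (Set.mem_insert_of_mem _ he')
    refine ⟨w, ih hw (fun s hs => Set.mem_insert_of_mem _ (hS s hs)) (by omega)
      (Set.mem_insert_of_mem _ he) (Set.mem_insert _ _) hz,
      fun hx => hy ((h.mem_iff hS he').2 hx), hzy.imp hzw.1.1 hzw.2.1⟩

theorem near_iff {S : Set V} (h : G.BackForth p L) (hS : ∀ s ∈ S, (s, s) ∈ L) {k : ℕ} (hk : k ≤ p)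
    {e f : V × V} (he : e ∈ L) (hf : f ∈ L) :
    G.Near Sᶜ k e.1 f.1 ↔ G.Near Sᶜ k e.2 f.2 :=
  ⟨h.near hS hk he hf, h.swap.near (S := S) hS hk (e := e.swap) (e' := f.swap) he hf⟩

/-- Duplicator can answer the elements of a finite set chosen on the right, one per round. -/
theorem exists_extend (X : Finset V) (h : G.BackForth (p + X.card) L) :
    ∃ M, L ⊆ M ∧ G.BackForth p M ∧ ∀ y ∈ X, ∃ x, (x, y) ∈ M := by
  classical
  induction X using Finset.induction_on generalizing L with
  | empty => exact ⟨L, subset_rfl, h, by simp⟩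
  | insert a X ha ih =>
    rw [Finset.card_insert_of_notMem ha, ← add_assoc] at h
    obtain ⟨x, hx⟩ := h.2.2 a
    obtain ⟨M, hM, hbf, hX⟩ := ih hx
    refine ⟨M, (Set.subset_insert _ _).trans hM, hbf, fun y hy => ?_⟩
    rcases Finset.mem_insert.1 hy with rfl | hy
    · exact ⟨x, hM (Set.mem_insert _ _)⟩
    · exact hX y hy

open Language in
-- The easy direction of the Ehrenfeucht–Fraïssé theorem: each quantifier spends one round, and
-- since all terms are variables, atoms are settled by the partial isomorphism.
theorem realize_iff {α : Type*} {n : ℕ} (φ : Language.graph.BoundedFormula α n)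
    (hφ : φ.quantifierRank ≤ p) (h : G.BackForth p L) {v v' : α → V} {xs xs' : Fin n → V}
    (hv : ∀ i, (v i, v' i) ∈ L) (hxs : ∀ i, (xs i, xs' i) ∈ L) :
    letI := G.structure
    φ.Realize v xs ↔ φ.Realize v' xs' := by
  let := G.structure
  have hterm : ∀ {n : ℕ} {L : Set (V × V)} {xs xs' : Fin n → V}
      (t : Language.graph.Term (α ⊕ Fin n)), (∀ i, (v i, v' i) ∈ L) → (∀ i, (xs i, xs' i) ∈ L) →
      (t.realize (Sum.elim v xs), t.realize (Sum.elim v' xs')) ∈ L := by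
    intro n L xs xs' t hv hxs
    cases t with
    | var i => cases i with
      | inl i => exact hv i
      | inr i => exact hxs i
    | func f _ => exact isEmptyElim f
  change φ.Realize v xs ↔ φ.Realize v' xs'
  induction φ generalizing p L with
  | falsum => exact Iff.rfl
  | equal t₁ t₂ =>
    exact (h.isPartialIso _ (hterm t₁ hv hxs) _ (hterm t₂ hv hxs)).1
  | rel R ts =>
    cases R
    exact (h.isPartialIso _ (hterm (ts 0) hv hxs) _ (hterm (ts 1) hv hxs)).2
  | imp φ ψ ih₁ ih₂ =>
    exact imp_congr (ih₁ ((le_max_left _ _).trans hφ) h hv hxs)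
      (ih₂ ((le_max_right _ _).trans hφ) h hv hxs)
  | all φ ih =>
    have hφ' : φ.quantifierRank + 1 ≤ p := hφ
    obtain ⟨p, rfl⟩ : ∃ p', p = p' + 1 := ⟨p - 1, by omega⟩
    have step : ∀ x y, G.BackForth p (insert (x, y) L) →
        (φ.Realize v (Fin.snoc xs x) ↔ φ.Realize v' (Fin.snoc xs' y)) := by
      intro x y hxy
      refine ih (by omega) hxy (fun i => Set.mem_insert_of_mem _ (hv i)) fun i => ?_
      refine Fin.lastCases ?_ (fun i => ?_) i
      · simp
      · simpa using Or.inr (hxs i)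
    constructor
    · intro H y
      obtain ⟨x, hx⟩ := h.2.2 y
      exact (step x y hx).1 (H x)
    · intro H x
      obtain ⟨y, hy⟩ := h.2.1 x
      exact (step x y hy).2 (H y)

end BackForth

end SimpleGraph

/-! ### Composing games on parts that are far apart -/

namespace SimpleGraph

variable {V : Type*} {G : SimpleGraph V}

/-- The rank of types of the parts that decides `q` further rounds, for parts of at most `D`
pairs. -/
def partRank (D q : ℕ) : ℕ := q * (D + 1) + 4 ^ (q + 1)

variable (G) in
/-- A position of the Ehrenfeucht–Fraïssé game that is split into parts, all containing the
diagonal of `S`. Each part is good for duplicator for many rounds, and distinct parts are far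
from each other outside `S`, on both sides. -/
structure IsSplitPosition (S : Set V) (D q : ℕ) {κ : Type*} (P : κ → Set (V × V)) : Prop where
  diag : ∀ k, ∀ s ∈ S, (s, s) ∈ P k
  card : ∀ k, (P k).ncard + q ≤ D
  backForth : ∀ k, G.BackForth (partRank D q) (P k)
  far : ∀ k l, k ≠ l → ∀ e ∈ P k, ∀ e' ∈ P l,
    ¬ G.Near Sᶜ (4 ^ q) e.1 e'.1 ∧ ¬ G.Near Sᶜ (4 ^ q) e.2 e'.2

namespace IsSplitPosition

variable {S : Set V} {D q : ℕ} {κ : Type*} {P : κ → Set (V × V)}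

theorem swap (h : G.IsSplitPosition S D q P) :
    G.IsSplitPosition S D q fun k => Prod.swap ⁻¹' P k where
  diag k s hs := h.diag k s hs
  card k := by
    rw [← Set.image_swap_eq_preimage_swap, Set.ncard_image_of_injective _ Prod.swap_injective]
    exact h.card k
  backForth k := (h.backForth k).swap
  far k l hkl e he e' he' := (h.far k l hkl _ he _ he').symm

/-- A pair that meets `S` is diagonal and so belongs to every part, which reduces it to one part.
Pairs off `S` from different parts are neither equal nor adjacent on either side, being more than
one step apart. -/
theorem isPartialIso (h : G.IsSplitPosition S D q P) : G.IsPartialIso (⋃ k, P k) := by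
  intro e he e' he'
  obtain ⟨k, he⟩ := Set.mem_iUnion.1 he
  obtain ⟨l, he'⟩ := Set.mem_iUnion.1 he'
  have hdiag : ∀ k, ∀ e ∈ P k, e.1 ∈ S ∨ e.2 ∈ S → e = (e.1, e.1) ∧ e.1 ∈ S := by
    rintro k ⟨x, y⟩ he hxy
    have hx : x ∈ S := hxy.elim id ((h.backForth k).mem_iff (h.diag k) he).2
    have := ((h.backForth k).isPartialIso _ he _ (h.diag k x hx)).1.1 rfl
    simp only at this
    subst this
    exact ⟨rfl, hx⟩
  by_cases hkl : k = l
  · subst hkl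
    exact (h.backForth k).isPartialIso e he e' he'
  by_cases h1 : e.1 ∈ S ∨ e.2 ∈ S
  · obtain ⟨h1, h2⟩ := hdiag k e he h1
    exact (h.backForth l).isPartialIso e (h1 ▸ h.diag l _ h2) e' he'
  by_cases h2 : e'.1 ∈ S ∨ e'.2 ∈ S
  · obtain ⟨h1, h2⟩ := hdiag l e' he' h2
    exact (h.backForth k).isPartialIso e he e' (h1 ▸ h.diag k _ h2)
  push Not at h1 h2
  have hpos : 1 ≤ 4 ^ q := Nat.one_le_pow _ _ (by norm_num)
  have hf := h.far k l hkl e he e' he'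
  refine ⟨iff_of_false ?_ ?_, iff_of_false ?_ ?_⟩
  · intro h'; exact hf.1 (h' ▸ Near.refl h1.1)
  · intro h'; exact hf.2 (h' ▸ Near.refl h1.2)
  · intro h'; exact hf.1 ((Near.of_adj h1.1 h2.1 h').mono_le hpos)
  · intro h'; exact hf.2 ((Near.of_adj h1.2 h2.2 h').mono_le hpos)

/-- A set of vertices scattered at distance `2 * r` and near the right side of a part can be
pulled back to the left side. -/
theorem exists_scattered_left [Finite V] (h : G.IsSplitPosition S D (q + 1) P) (c : V) (k : κ)
    (X : Finset V)
    (hT : ∀ x ∈ X, G.BackForth (partRank D q) (insert (c, x) ((fun s => (s, s)) '' S)))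
    (hX : ∀ x ∈ X, ∀ y ∈ X, x ≠ y → ¬ G.Near Sᶜ (2 * 4 ^ q) x y)
    (hN : ∀ x ∈ X, ∃ e ∈ P k, G.Near Sᶜ (4 ^ q) x e.2) :
    ∃ Y : Finset V, Y.card = X.card ∧
      (∀ x ∈ Y, G.BackForth (partRank D q) (insert (c, x) ((fun s => (s, s)) '' S))) ∧
      (∀ x ∈ Y, ∀ y ∈ Y, x ≠ y → ¬ G.Near Sᶜ (2 * 4 ^ q) x y) ∧
      ∀ x ∈ Y, ∃ e ∈ P k, G.Near Sᶜ (4 ^ q) x e.1 := by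
  classical
  -- Members of `X` with the same witness in `P k` would be within 2 * 4^q of each other, so `X`
  -- injects into `P k`.
  have hcard : X.card ≤ D := by
    choose! w hwP hwN using hN
    have hinj : Set.InjOn w X := by
      intro x hx y hy hxy
      by_contra hne
      refine hX x hx y hy hne ?_
      have := (hwN x hx).trans (hxy ▸ (hwN y hy).symm)
      rwa [two_mul]
    have h1 : (X.image w).card ≤ (P k).ncard := by
      rw [← Set.ncard_coe_finset]
      refine Set.ncard_le_ncard ?_ (Set.toFinite _)
      intro e he
      obtain ⟨x, hx, rfl⟩ := Finset.mem_image.1 (Finset.mem_coe.1 he)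
      exact hwP x hx
    rw [Finset.card_image_of_injOn hinj] at h1
    have := h.card k
    omega
  have hpow : 4 ^ (q + 1 + 1) = 4 * 4 ^ (q + 1) := by ring
  have hpow' : 4 ^ (q + 1) = 4 * 4 ^ q := by ring
  -- The summand D + 1 gained per level of `partRank` pays for playing all of `X`; the power of 4
  -- leaves enough rounds to measure distances.
  have hrank : partRank D q + X.card ≤ partRank D (q + 1) := by
    unfold partRank
    have : (q + 1) * (D + 1) = q * (D + 1) + (D + 1) := by ring
    omega
  have hrank' : 2 * 4 ^ q ≤ partRank D q := by unfold partRank; omega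
  obtain ⟨M, hPM, hM, hXM⟩ := ((h.backForth k).mono_le hrank).exists_extend X
  have hdiag : ∀ s ∈ S, (s, s) ∈ M := fun s hs => hPM (h.diag k s hs)
  choose! w hw using hXM
  have hinj : Set.InjOn w X := by
    intro x hx y hy hxy
    exact (hM.isPartialIso _ (hw x hx) _ (hw y hy)).1.1 hxy
  refine ⟨X.image w, Finset.card_image_of_injOn hinj, ?_, ?_, ?_⟩
  · intro _ hwx
    obtain ⟨x, hx, rfl⟩ := Finset.mem_image.1 hwx
    -- The type of `c` passes to `x`, and from `x` back to its preimage `w x`.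
    refine ((hT x hx).comp hM.swap).mono ?_
    rintro e (rfl | ⟨s, hs, rfl⟩)
    · exact ⟨x, Set.mem_insert _ _, hw x hx⟩
    · exact ⟨s, Set.mem_insert_of_mem _ ⟨s, hs, rfl⟩, hdiag s hs⟩
  · intro _ hwx _ hwy hxy
    obtain ⟨x, hx, rfl⟩ := Finset.mem_image.1 hwx
    obtain ⟨y, hy, rfl⟩ := Finset.mem_image.1 hwy
    rw [hM.near_iff hdiag hrank' (e := (w x, x)) (f := (w y, y)) (hw x hx) (hw y hy)]
    exact hX x hx y hy fun h' => hxy (by rw [h'])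
  · intro _ hwx
    obtain ⟨x, hx, rfl⟩ := Finset.mem_image.1 hwx
    obtain ⟨e, he, hxe⟩ := hN x hx
    refine ⟨e, he, ?_⟩
    exact (hM.near_iff hdiag (by omega) (e := (w x, x)) (f := e) (hw x hx) (hPM he)).2 hxe

/-- A vertex far from the left side of all parts has a counterpart of the same type far from the
right side of all parts: otherwise all vertices of its type are near the right side, and the
maximal size of a scattered set of such vertices would differ when counted on the two sides. -/
theorem exists_far [Finite V] [Finite κ] (h : G.IsSplitPosition S D (q + 1) P) (c : V)
    (hc : ∀ k, ∀ e ∈ P k, ¬ G.Near Sᶜ (3 * 4 ^ q) c e.1) :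
    ∃ c', G.BackForth (partRank D q) (insert (c, c') ((fun s => (s, s)) '' S)) ∧
      ∀ k, ∀ e ∈ P k, ¬ G.Near Sᶜ (4 ^ q) c' e.2 := by
  classical
  by_contra! hcon
  have := Fintype.ofFinite V
  have := Fintype.ofFinite κ
  set T : V → Prop := fun z => G.BackForth (partRank D q) (insert (c, z) ((fun s => (s, s)) '' S))
    with hTdef
  have hpow : 4 ^ (q + 1) = 4 * 4 ^ q := by ring
  let good : κ → Finset V → Prop := fun k X => (∀ x ∈ X, T x) ∧
    (∀ x ∈ X, ∀ y ∈ X, x ≠ y → ¬ G.Near Sᶜ (2 * 4 ^ q) x y) ∧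
    ∀ x ∈ X, ∃ e ∈ P k, G.Near Sᶜ (4 ^ q) x e.2
  have hmax : ∀ k, ∃ X, good k X ∧ ∀ Y, good k Y → Y.card ≤ X.card := by
    intro k
    obtain ⟨X, hX, hmax⟩ := Finset.exists_max_image
      (Finset.univ.filter (good k)) Finset.card ⟨∅, by simp [good]⟩
    exact ⟨X, (Finset.mem_filter.1 hX).2, fun Y hY => hmax Y (by simpa using hY)⟩
  choose X hX hXmax using hmax
  choose Y hYcard hYT hYX hYN using fun k =>
    h.exists_scattered_left c k (X k) (hX k).1 (hX k).2.1 (hX k).2.2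
  -- The sets pulled back to the left, together with `c`, are jointly scattered and have one element
  -- too many: by `hcon` each element is near the right side of some part, and part `k` accommodates
  -- at most `(X k).card` of them.
  set Z : Finset V := insert c (Finset.univ.biUnion Y) with hZ
  have hcT : T c := BackForth.of_diagonal (by rintro e (rfl | ⟨s, hs, rfl⟩) <;> rfl)
  have hcY : ∀ k, ∀ y ∈ Y k, ¬ G.Near Sᶜ (2 * 4 ^ q) c y := by
    intro k y hy hn
    obtain ⟨e, he, hye⟩ := hYN k y hy
    exact hc k e he ((hn.trans hye).mono_le (by omega))
  have hYY : ∀ k l, k ≠ l → ∀ x ∈ Y k, ∀ y ∈ Y l, ¬ G.Near Sᶜ (2 * 4 ^ q) x y := by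
    intro k l hkl x hx y hy hn
    obtain ⟨e, he, hxe⟩ := hYN k x hx
    obtain ⟨e', he', hye⟩ := hYN l y hy
    -- The distances add up to 4^q + 2 * 4^q + 4^q = 4^(q + 1).
    exact (h.far k l hkl e he e' he').1
      (((hxe.symm.trans hn).trans hye).mono_le (by omega))
  have hYdisj : ∀ k l, k ≠ l → Disjoint (Y k) (Y l) := by
    intro k l hkl
    rw [Finset.disjoint_left]
    intro x hx hx'
    obtain ⟨e, he, hxe⟩ := hYN k x hx
    exact hYY k l hkl x hx x hx' (Near.refl hxe.left_mem)
  have hZT : ∀ z ∈ Z, T z := by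
    intro z hz
    rcases Finset.mem_insert.1 hz with rfl | hz
    · exact hcT
    · obtain ⟨k, -, hz⟩ := Finset.mem_biUnion.1 hz
      exact hYT k z hz
  have hZX : ∀ x ∈ Z, ∀ y ∈ Z, x ≠ y → ¬ G.Near Sᶜ (2 * 4 ^ q) x y := by
    intro x hxZ y hyZ hxy
    rcases Finset.mem_insert.1 hxZ with rfl | hx <;> rcases Finset.mem_insert.1 hyZ with rfl | hy
    · exact absurd rfl hxy
    · obtain ⟨k, -, hy⟩ := Finset.mem_biUnion.1 hy
      exact hcY k y hy
    · obtain ⟨k, -, hx⟩ := Finset.mem_biUnion.1 hx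
      exact fun hn => hcY k x hx hn.symm
    · obtain ⟨k, -, hx⟩ := Finset.mem_biUnion.1 hx
      obtain ⟨l, -, hy⟩ := Finset.mem_biUnion.1 hy
      by_cases hkl : k = l
      · subst hkl
        exact hYX k x hx y hy hxy
      · exact hYY k l hkl x hx y hy
  have hcard : Z.card = ∑ k, (X k).card + 1 := by
    rw [hZ, Finset.card_insert_of_notMem, Finset.card_biUnion fun k _ l _ hkl => hYdisj k l hkl]
    · simp [hYcard]
    · intro hcm
      obtain ⟨k, -, hck⟩ := Finset.mem_biUnion.1 hcm
      obtain ⟨e, he, hxe⟩ := hYN k c hck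
      exact hcY k c hck (Near.refl hxe.left_mem)
  let W : κ → Finset V := fun k => Z.filter fun z => ∃ e ∈ P k, G.Near Sᶜ (4 ^ q) z e.2
  have hW : ∀ k, (W k).card ≤ (X k).card := fun k => hXmax k (W k)
    ⟨fun x hx => hZT x (Finset.mem_filter.1 hx).1,
      fun x hx y hy => hZX x (Finset.mem_filter.1 hx).1 y (Finset.mem_filter.1 hy).1,
      fun x hx => (Finset.mem_filter.1 hx).2⟩
  have hsub : Z ⊆ Finset.univ.biUnion W := by
    intro z hz
    obtain ⟨k, e, he, hn⟩ := hcon z (hZT z hz)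
    exact Finset.mem_biUnion.2 ⟨k, Finset.mem_univ _, Finset.mem_filter.2 ⟨hz, e, he, hn⟩⟩
  have h1 := (Finset.card_le_card hsub).trans Finset.card_biUnion_le
  have h2 : ∑ k, (W k).card ≤ ∑ k, (X k).card := Finset.sum_le_sum fun k _ => hW k
  omega

/-- One round of the game from a split position. -/
theorem exists_step [Finite V] {κ : Type} [Finite κ] {P : κ → Set (V × V)}
    (h : G.IsSplitPosition S D (q + 1) P) (hS : S.ncard + 1 + q ≤ D) (c : V) :
    ∃ (c' : V) (κ' : Type) (_ : Finite κ') (P' : κ' → Set (V × V)),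
      G.IsSplitPosition S D q P' ∧ insert (c, c') (⋃ k, P k) ⊆ ⋃ k, P' k := by
  classical
  have hpow : 4 ^ (q + 1) = 4 * 4 ^ q := by ring
  have hpow' : 4 ^ (q + 1 + 1) = 4 * 4 ^ (q + 1) := by ring
  have hrank : partRank D q + 1 ≤ partRank D (q + 1) := by
    unfold partRank
    have : (q + 1) * (D + 1) = q * (D + 1) + (D + 1) := by ring
    omega
  have hrank' : 3 * 4 ^ q ≤ partRank D q := by unfold partRank; omega
  -- With threshold 3 * 4^q, a near move joins its part and stays beyond 4^q from the others, as 3 +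
  -- 1 = 4. A far move opens a new part.
  by_cases hc : ∃ k, ∃ e ∈ P k, G.Near Sᶜ (3 * 4 ^ q) c e.1
  · obtain ⟨k, e, he, hce⟩ := hc
    obtain ⟨c', hc'⟩ := ((h.backForth k).mono_le hrank).2.1 c
    have hce' : G.Near Sᶜ (3 * 4 ^ q) c' e.2 :=
      hc'.near (fun s hs => Set.mem_insert_of_mem _ (h.diag k s hs)) hrank' (Set.mem_insert _ _)
        (Set.mem_insert_of_mem _ he) hce
    have hfar : ∀ l, k ≠ l → ∀ e' ∈ P l,
        ¬ G.Near Sᶜ (4 ^ q) c e'.1 ∧ ¬ G.Near Sᶜ (4 ^ q) c' e'.2 := fun l hkl e' he' =>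
      ⟨fun hn => (h.far k l hkl e he e' he').1 ((hce.symm.trans hn).mono_le (by omega)),
        fun hn => (h.far k l hkl e he e' he').2 ((hce'.symm.trans hn).mono_le (by omega))⟩
    have hfar' : ∀ l m, l ≠ m → ∀ e ∈ P l, ∀ e' ∈ P m,
        ¬ G.Near Sᶜ (4 ^ q) e.1 e'.1 ∧ ¬ G.Near Sᶜ (4 ^ q) e.2 e'.2 := fun l m hlm e he e' he' =>
      ⟨fun hn => (h.far l m hlm e he e' he').1 (hn.mono_le (by omega)),
        fun hn => (h.far l m hlm e he e' he').2 (hn.mono_le (by omega))⟩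
    have hmem : ∀ l e', e' ∈ Function.update P k (insert (c, c') (P k)) l →
        e' ∈ P l ∨ (l = k ∧ e' = (c, c')) := by
      intro l e' he'
      by_cases hl : l = k
      · subst hl
        rw [Function.update_self] at he'
        exact he'.elim (fun h => Or.inr ⟨rfl, h⟩) Or.inl
      · rw [Function.update_of_ne hl] at he'
        exact Or.inl he'
    have hsub : ∀ l, P l ⊆ Function.update P k (insert (c, c') (P k)) l := by
      intro l
      by_cases hl : l = k
      · subst hl
        rw [Function.update_self]
        exact Set.subset_insert _ _
      · rw [Function.update_of_ne hl]
    refine ⟨c', κ, inferInstance, Function.update P k (insert (c, c') (P k)),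
      ⟨fun l s hs => hsub l (h.diag l s hs), fun l => ?_, fun l => ?_, ?_⟩, ?_⟩
    · by_cases hl : l = k
      · subst hl
        rw [Function.update_self]
        have := Set.ncard_insert_le (c, c') (P l)
        have := h.card l
        omega
      · rw [Function.update_of_ne hl]
        have := h.card l
        omega
    · by_cases hl : l = k
      · subst hl
        rw [Function.update_self]
        exact hc'
      · rw [Function.update_of_ne hl]
        exact (h.backForth l).mono_le (by omega)
    · intro l m hlm e₁ he₁ e₂ he₂
      rcases hmem l e₁ he₁ with h1 | ⟨rfl, rfl⟩ <;> rcases hmem m e₂ he₂ with h2 | ⟨rfl, rfl⟩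
      · exact hfar' l m hlm e₁ h1 e₂ h2
      · have := hfar l (Ne.symm hlm) e₁ h1
        exact ⟨fun hn => this.1 hn.symm, fun hn => this.2 hn.symm⟩
      · exact hfar m hlm e₂ h2
      · exact absurd rfl hlm
    · rintro e' (rfl | he')
      · exact Set.mem_iUnion.2 ⟨k, by rw [Function.update_self]; exact Set.mem_insert _ _⟩
      · obtain ⟨l, hl⟩ := Set.mem_iUnion.1 he'
        exact Set.mem_iUnion.2 ⟨l, hsub l hl⟩
  · push Not at hc
    obtain ⟨c', hc', hfar⟩ := h.exists_far c hc
    have hnew : ∀ l, ∀ e ∈ insert (c, c') ((fun s => (s, s)) '' S), ∀ e' ∈ P l,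
        ¬ G.Near Sᶜ (4 ^ q) e.1 e'.1 ∧ ¬ G.Near Sᶜ (4 ^ q) e.2 e'.2 := by
      rintro l e (rfl | ⟨s, hs, rfl⟩) e' he'
      · exact ⟨fun hn => hc l e' he' (hn.mono_le (by omega)), hfar l e' he'⟩
      · exact ⟨fun hn => hn.left_mem hs, fun hn => hn.left_mem hs⟩
    refine ⟨c', Option κ, inferInstance,
      fun o => o.elim (insert (c, c') ((fun s => (s, s)) '' S)) P, ⟨?_, ?_, ?_, ?_⟩, ?_⟩
    · rintro (_ | l) s hs
      · exact Set.mem_insert_of_mem _ ⟨s, hs, rfl⟩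
      · exact h.diag l s hs
    · rintro (_ | l)
      · have h1 := Set.ncard_insert_le (c, c') ((fun s => (s, s)) '' S)
        have h2 := Set.ncard_image_le (f := fun s : V => (s, s)) (Set.toFinite S)
        simp only [Option.elim]
        omega
      · have := h.card l
        simp only [Option.elim]
        omega
    · rintro (_ | l)
      · exact hc'
      · exact (h.backForth l).mono_le (by omega)
    · rintro (_ | l) (_ | m) hlm e₁ he₁ e₂ he₂
      · exact absurd rfl hlm
      · exact hnew m e₁ he₁ e₂ he₂
      · have := hnew l e₂ he₂ e₁ he₁
        exact ⟨fun hn => this.1 hn.symm, fun hn => this.2 hn.symm⟩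
      · have := h.far l m (fun h => hlm (by rw [h])) e₁ he₁ e₂ he₂
        exact ⟨fun hn => this.1 (hn.mono_le (by omega)), fun hn => this.2 (hn.mono_le (by omega))⟩
    · rintro e' (rfl | he')
      · exact Set.mem_iUnion.2 ⟨none, Set.mem_insert _ _⟩
      · obtain ⟨l, hl⟩ := Set.mem_iUnion.1 he'
        exact Set.mem_iUnion.2 ⟨some l, hl⟩

/-- Duplicator wins the game from a split position. -/
theorem backForth_iUnion [Finite V] {κ : Type} [Finite κ] {P : κ → Set (V × V)}
    (h : G.IsSplitPosition S D q P) (hS : S.ncard + q ≤ D) : G.BackForth q (⋃ k, P k) := by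
  induction q generalizing κ with
  | zero => exact h.isPartialIso
  | succ q ih =>
    refine ⟨h.isPartialIso, fun c => ?_, fun c => ?_⟩
    · obtain ⟨c', κ', _, P', hP', hsub⟩ := h.exists_step (by omega) c
      exact ⟨c', (ih hP' (by omega)).mono hsub⟩
    · obtain ⟨c', κ', _, P', hP', hsub⟩ := h.swap.exists_step (by omega) c
      refine ⟨c', (ih hP' (by omega)).swap.mono ?_⟩
      rintro e (rfl | he)
      · exact hsub (Set.mem_insert _ _)
      · refine hsub (Set.mem_insert_of_mem _ ?_)
        simpa using he

end IsSplitPosition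

end SimpleGraph

-- Counting game types

universe u

namespace SimpleGraph

/-- The type of all possible types of rank `p` of `ι`-tuples of vertices. -/
def GameType : ℕ → Type u → Type u
  | 0, ι => ι → ι → Prop × Prop
  | p + 1, ι => (ι → ι → Prop × Prop) × Set (GameType p (Option ι))

/-- The type of rank `p` of a tuple of vertices: its atomic type, and for `p > 0` the types of
rank `p - 1` of its extensions by one vertex. -/
def gameType {V : Type*} (G : SimpleGraph V) : (p : ℕ) → {ι : Type u} → (ι → V) → GameType p ι
  | 0, _, a => fun i j => (a i = a j, G.Adj (a i) (a j))
  | p + 1, _, a => (fun i j => (a i = a j, G.Adj (a i) (a j)),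
      Set.range fun x => gameType G p fun o => o.elim x a)

/-- Equal types realize the same extension types, so every move has an answer of equal type one rank
lower. -/
theorem backForth_of_gameType_eq {V : Type*} {G : SimpleGraph V} {p : ℕ} {ι : Type u}
    {a b : ι → V} (h : G.gameType p a = G.gameType p b) :
    G.BackForth p (Set.range fun i => (a i, b i)) := by
  have hatom : ∀ {ι : Type u} {a b : ι → V},
      (fun i j => (a i = a j, G.Adj (a i) (a j))) = (fun i j => (b i = b j, G.Adj (b i) (b j))) →
      G.IsPartialIso (Set.range fun i => (a i, b i)) := by
    rintro ι a b h _ ⟨i, rfl⟩ _ ⟨j, rfl⟩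
    have := congrFun (congrFun h i) j
    simp only [Prod.mk.injEq, eq_iff_iff] at this
    exact this
  have hins : ∀ {ι : Type u} {a b : ι → V} (x y : V),
      insert (x, y) (Set.range fun i => (a i, b i)) ⊆
        Set.range fun o : Option ι => (o.elim x a, o.elim y b) := by
    rintro ι a b x y e (rfl | ⟨i, rfl⟩)
    · exact ⟨none, rfl⟩
    · exact ⟨some i, rfl⟩
  induction p generalizing ι with
  | zero => exact hatom h
  | succ p ih =>
    obtain ⟨h1, h2⟩ := Prod.mk.inj h
    refine ⟨hatom h1, fun x => ?_, fun y => ?_⟩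
    · obtain ⟨y, hy⟩ := h2.subset ⟨x, rfl⟩
      exact ⟨y, (ih hy.symm).mono (hins x y)⟩
    · obtain ⟨x, hx⟩ := h2.superset ⟨y, rfl⟩
      exact ⟨x, (ih hx).mono (hins x y)⟩

/-- A bound for the number of types of rank `p` of tuples of length at most `M - p`. -/
def gameTypeBound (M p : ℕ) : ℕ := (fun x => 4 ^ (M * M) * 2 ^ x)^[p] (4 ^ (M * M))

/-- Lowering the rank by one lengthens the tuple by one, so tuples at every level have length at
most `M` and at most 4^(M * M) atomic types. The graph does not enter the bound. -/
theorem card_gameType_le {M p : ℕ} {ι : Type u} [Finite ι] (h : Nat.card ι + p ≤ M) :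
    Finite (GameType p ι) ∧ Nat.card (GameType p ι) ≤ gameTypeBound M p := by
  have hatom : ∀ (ι : Type u) [Finite ι], Nat.card ι ≤ M →
      Nat.card (ι → ι → Prop × Prop) ≤ 4 ^ (M * M) := by
    intro ι _ h
    rw [Nat.card_fun, Nat.card_fun, Nat.card_prod, Nat.card_eq_fintype_card, Fintype.card_prop,
      ← pow_mul]
    exact Nat.pow_le_pow_right (by norm_num) (Nat.mul_le_mul h h)
  induction p generalizing ι with
  | zero => exact ⟨inferInstanceAs (Finite (ι → ι → Prop × Prop)), hatom ι h⟩
  | succ p ih =>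
    have hopt : Nat.card (Option ι) = Nat.card ι + 1 := Finite.card_option
    obtain ⟨hfin, hle⟩ := ih (ι := Option ι) (by omega)
    refine ⟨inferInstanceAs (Finite ((ι → ι → Prop × Prop) × Set (GameType p (Option ι)))), ?_⟩
    change Nat.card ((ι → ι → Prop × Prop) × (GameType p (Option ι) → Prop)) ≤ _
    rw [Nat.card_prod, Nat.card_fun (β := Prop), Nat.card_eq_fintype_card (α := Prop),
      Fintype.card_prop, gameTypeBound, Function.iterate_succ_apply']
    exact Nat.mul_le_mul (hatom ι (by omega)) (Nat.pow_le_pow_right (by norm_num) hle)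

end SimpleGraph

/-! ### Ramsey-type lemmas and star models in bipartite graphs -/

/-- A crude form of Ramsey's theorem for pairs. -/
theorem Finset.exists_homogeneous {I : Type*} {R : I → I → Prop} (hR : ∀ x y, R x y → R y x)
    (a b : ℕ) (J : Finset I) (hJ : 2 ^ (a + b) ≤ J.card) :
    (∃ K ⊆ J, K.card = a ∧ ∀ x ∈ K, ∀ y ∈ K, x ≠ y → R x y) ∨
      ∃ K ⊆ J, K.card = b ∧ ∀ x ∈ K, ∀ y ∈ K, x ≠ y → ¬ R x y := by
  classical
  induction a generalizing b J with
  | zero => exact Or.inl ⟨∅, by simp⟩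
  | succ a iha =>
    induction b generalizing J with
    | zero => exact Or.inr ⟨∅, by simp⟩
    | succ b ihb =>
      have hpos : 0 < 2 ^ (a + 1 + (b + 1)) := by positivity
      obtain ⟨v, hv⟩ := Finset.card_pos.1 (hpos.trans_le hJ)
      have hsum := Finset.card_filter_add_card_filter_not (s := J.erase v) (R v)
      rw [Finset.card_erase_of_mem hv] at hsum
      have hpow : 2 ^ (a + 1 + (b + 1)) = 2 * 2 ^ (a + (b + 1)) := by ring
      by_cases hA : 2 ^ (a + (b + 1)) ≤ ((J.erase v).filter (R v)).card
      · obtain ⟨K, hK, hcard, hRK⟩ | ⟨K, hK, h⟩ := iha (b + 1) _ hA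
        · have hv' : ∀ x ∈ K, x ∈ J ∧ x ≠ v ∧ R v x := fun x hx => by
            have := hK hx
            simp only [Finset.mem_filter, Finset.mem_erase] at this
            tauto
          refine Or.inl ⟨insert v K, ?_, ?_, ?_⟩
          · exact Finset.insert_subset hv fun x hx => (hv' x hx).1
          · rw [Finset.card_insert_of_notMem fun h => (hv' v h).2.1 rfl, hcard]
          · intro x hx y hy hxy
            rcases Finset.mem_insert.1 hx with h1 | h1 <;>
              rcases Finset.mem_insert.1 hy with h2 | h2
            · exact absurd (h1.trans h2.symm) hxy
            · exact h1 ▸ (hv' y h2).2.2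
            · exact h2 ▸ hR _ _ (hv' x h1).2.2
            · exact hRK x h1 y h2 hxy
        · exact Or.inr ⟨K, hK.trans ((Finset.filter_subset _ _).trans (Finset.erase_subset _ _)), h⟩
      · have hB : 2 ^ (a + 1 + b) ≤ ((J.erase v).filter (fun x => ¬ R v x)).card := by
          have : a + 1 + b = a + (b + 1) := by ring
          rw [this]
          omega
        obtain ⟨K, hK, h⟩ | ⟨K, hK, hcard, hRK⟩ := ihb _ hB
        · exact Or.inl ⟨K, hK.trans ((Finset.filter_subset _ _).trans (Finset.erase_subset _ _)), h⟩
        · have hv' : ∀ x ∈ K, x ∈ J ∧ x ≠ v ∧ ¬ R v x := fun x hx => by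
            have := hK hx
            simp only [Finset.mem_filter, Finset.mem_erase] at this
            tauto
          refine Or.inr ⟨insert v K, ?_, ?_, ?_⟩
          · exact Finset.insert_subset hv fun x hx => (hv' x hx).1
          · rw [Finset.card_insert_of_notMem fun h => (hv' v h).2.1 rfl, hcard]
          · intro x hx y hy hxy
            rcases Finset.mem_insert.1 hx with h1 | h1 <;>
              rcases Finset.mem_insert.1 hy with h2 | h2
            · exact absurd (h1.trans h2.symm) hxy
            · exact h1 ▸ (hv' y h2).2.2
            · exact h2 ▸ fun h => (hv' x h1).2.2 (hR _ _ h)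
            · exact hRK x h1 y h2 hxy

/-- A digraph of bounded out-degree has large independent sets. -/
theorem Finset.exists_independent_of_outDegree_le {I : Type*} {R : I → I → Prop} [DecidableRel R]
    {D : ℕ} (m : ℕ) (J : Finset I) (hD : ∀ x ∈ J, (J.filter (R x)).card ≤ D)
    (hJ : m * (2 * D + 1) ≤ J.card) :
    ∃ K ⊆ J, K.card = m ∧ ∀ x ∈ K, ∀ y ∈ K, x ≠ y → ¬ R x y := by
  classical
  induction m generalizing J with
  | zero => exact ⟨∅, by simp⟩
  | succ m ih =>
    have hne : J.Nonempty := by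
      rw [← Finset.card_pos]
      refine lt_of_lt_of_le ?_ hJ
      positivity
    -- The in-degrees have the same sum as the out-degrees, so some in-degree is at most `D`.
    -- Choosing `v` costs at most 2 * D + 1 vertices.
    obtain ⟨v, hv, hvD⟩ : ∃ v ∈ J, (J.filter fun x => R x v).card ≤ D := by
      refine Finset.exists_le_of_sum_le (f := fun v => (J.filter fun x => R x v).card)
        (g := fun _ => D) hne ?_
      calc ∑ v ∈ J, (J.filter fun x => R x v).card = ∑ x ∈ J, (J.filter (R x)).card :=
            (Finset.sum_card_bipartiteAbove_eq_sum_card_bipartiteBelow R).symm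
        _ ≤ ∑ _ ∈ J, D := Finset.sum_le_sum hD
    set J' := J \ insert v (J.filter (R v) ∪ J.filter fun x => R x v) with hJ'
    have hmem : ∀ x ∈ J', x ∈ J ∧ x ≠ v ∧ ¬ R v x ∧ ¬ R x v := fun x hx => by
      simp only [hJ', Finset.mem_sdiff, Finset.mem_insert, Finset.mem_union,
        Finset.mem_filter] at hx
      tauto
    have hsub : J' ⊆ J := fun x hx => (hmem x hx).1
    have hcard : m * (2 * D + 1) ≤ J'.card := by
      have h1 := Finset.le_card_sdiff (insert v (J.filter (R v) ∪ J.filter fun x => R x v)) J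
      have h2 := Finset.card_insert_le v (J.filter (R v) ∪ J.filter fun x => R x v)
      have h3 := Finset.card_union_le (J.filter (R v)) (J.filter fun x => R x v)
      have h4 := hD v hv
      have h5 : (m + 1) * (2 * D + 1) = m * (2 * D + 1) + (2 * D + 1) := by ring
      rw [hJ']
      omega
    obtain ⟨K, hK, hKcard, hKR⟩ := ih J' (fun x hx =>
      (Finset.card_le_card (Finset.filter_subset_filter _ hsub)).trans (hD x (hsub hx))) hcard
    refine ⟨insert v K, Finset.insert_subset hv (hK.trans hsub), ?_, ?_⟩
    · rw [Finset.card_insert_of_notMem fun h => (hmem v (hK h)).2.1 rfl, hKcard]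
    · intro x hx y hy hxy
      rcases Finset.mem_insert.1 hx with h1 | h1 <;> rcases Finset.mem_insert.1 hy with h2 | h2
      · exact absurd (h1.trans h2.symm) hxy
      · exact h1 ▸ (hmem y (hK h2)).2.2.1
      · exact h2 ▸ (hmem x (hK h1)).2.2.2
      · exact hKR x h1 y h2 hxy

/-- In the bipartite graph `E`, there are `t` vertices in `J` on the left, which together with
private neighbours on the right form the branch sets of a complete minor. -/
def HasStarModel {I Y : Type*} (E : I → Y → Prop) (J : Finset I) (t : ℕ) : Prop :=
  ∃ K ⊆ J, K.card = t ∧ ∃ Z : I → Set Y, (∀ j ∈ K, ∀ y ∈ Z j, E j y) ∧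
    (∀ j ∈ K, ∀ k ∈ K, j ≠ k → Disjoint (Z j) (Z k)) ∧
    ∀ j ∈ K, ∀ k ∈ K, j ≠ k → (∃ y ∈ Z j, E k y) ∨ ∃ y ∈ Z k, E j y

theorem HasStarModel.mono {I Y : Type*} {E E' : I → Y → Prop} {J J' : Finset I} {t : ℕ}
    (h : HasStarModel E J t) (hE : ∀ i y, E i y → E' i y) (hJ : J ⊆ J') :
    HasStarModel E' J' t := by
  obtain ⟨K, hK, hcard, Z, h1, h2, h3⟩ := h
  exact ⟨K, hK.trans hJ, hcard, Z, fun j hj y hy => hE _ _ (h1 j hj y hy), h2,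
    fun j hj k hk hjk => (h3 j hj k hk hjk).imp (fun ⟨y, hy, h⟩ => ⟨y, hy, hE _ _ h⟩)
      fun ⟨y, hy, h⟩ => ⟨y, hy, hE _ _ h⟩⟩

/-- The number of vertices on the left needed in `hasStarModel_of_degree_le`. -/
def starBound (D t : ℕ) : ℕ := (fun N => N * (2 * D + 1) + 1)^[t] 0

/-- If any two vertices on the left have a common neighbour and the vertices on the right have
bounded degree, then there is a large star model. -/
theorem hasStarModel_of_degree_le {I Y : Type*} {E : I → Y → Prop} [∀ y, DecidablePred (E · y)]
    {J : Finset I} {D t : ℕ} (hD : ∀ y, (J.filter (E · y)).card ≤ D)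
    (hE : ∀ i ∈ J, ∀ j ∈ J, i ≠ j → ∃ y, E i y ∧ E j y) (hJ : starBound D t ≤ J.card) :
    HasStarModel E J t := by
  classical
  induction t generalizing E J with
  | zero => exact ⟨∅, by simp, by simp, fun _ => ∅, by simp, by simp, by simp⟩
  | succ t ih =>
    rw [starBound, Function.iterate_succ_apply', ← starBound] at hJ
    obtain ⟨x, hx⟩ : J.Nonempty := Finset.card_pos.1 (by omega)
    have hc : ∀ z : I, ∃ y : Option Y, z ∈ J.erase x → ∃ w, y = some w ∧ E x w ∧ E z w := by
      intro z
      by_cases hz : z ∈ J.erase x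
      · obtain ⟨hzx, hzJ⟩ := Finset.mem_erase.1 hz
        obtain ⟨y, hy⟩ := hE x hx z hzJ hzx.symm
        exact ⟨some y, fun _ => ⟨y, rfl, hy⟩⟩
      · exact ⟨none, fun h => absurd h hz⟩
    choose c hc using hc
    -- `c z` is a chosen common neighbour of `x` and `z`. Independence means that within `K₀` the
    -- vertex `c z` sees only `z`, so removing all the `c z` destroys no common neighbour of two
    -- members of `K₀`.
    obtain ⟨K₀, hK₀, hcard, hK₀R⟩ := Finset.exists_independent_of_outDegree_le
      (R := fun z z' => ∃ w, c z = some w ∧ E z' w) (D := D) (starBound D t) (J.erase x) (by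
        intro z hz
        obtain ⟨w, hw, -⟩ := hc z hz
        refine (Finset.card_le_card ?_).trans (hD w)
        intro z' hz'
        obtain ⟨h1, w', hw', h2⟩ := Finset.mem_filter.1 hz'
        rw [hw, Option.some_inj] at hw'
        subst hw'
        exact Finset.mem_filter.2 ⟨Finset.mem_of_mem_erase h1, h2⟩) (by
        rw [Finset.card_erase_of_mem hx]; omega)
    have hK₀J : K₀ ⊆ J := hK₀.trans (Finset.erase_subset _ _)
    obtain ⟨K, hK, hKcard, Z, h1, h2, h3⟩ := ih
      (E := fun i y => E i y ∧ ∀ z ∈ K₀, c z ≠ some y) (J := K₀)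
      (fun y => (Finset.card_le_card fun z hz => by
        obtain ⟨hz, hzy, -⟩ := Finset.mem_filter.1 hz
        exact Finset.mem_filter.2 ⟨hK₀J hz, hzy⟩).trans (hD y))
      (by
        intro i hi j hj hij
        obtain ⟨y, hyi, hyj⟩ := hE i (hK₀J hi) j (hK₀J hj) hij
        have : ∀ z ∈ K₀, c z ≠ some y := by
          intro z hz hzy
          by_cases hzi : z = i
          · exact hK₀R z hz j hj (hzi ▸ hij) ⟨y, hzy, hyj⟩
          · exact hK₀R z hz i hi hzi ⟨y, hzy, hyi⟩
        exact ⟨y, ⟨hyi, this⟩, hyj, this⟩)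
      hcard.ge
    have hxK : ∀ j ∈ K, j ≠ x := fun j hj => (Finset.mem_erase.1 (hK₀ (hK hj))).1
    -- The new vertex `x` gets an empty star; each old star gains `c j`, which connects it to `x`.
    refine ⟨insert x K, Finset.insert_subset hx (hK.trans hK₀J), ?_,
      fun j => {y | j ≠ x ∧ (y ∈ Z j ∨ c j = some y)}, ?_, ?_, ?_⟩
    · rw [Finset.card_insert_of_notMem fun h => hxK x h rfl, hKcard]
    · rintro j hj y ⟨hjx, hy⟩
      have hjK : j ∈ K := (Finset.mem_insert.1 hj).resolve_left hjx
      rcases hy with hy | hy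
      · exact (h1 j hjK y hy).1
      · obtain ⟨w, hw, -, hjw⟩ := hc j (hK₀ (hK hjK))
        rw [hy, Option.some_inj] at hw
        exact hw ▸ hjw
    · intro j hj k hk hjk
      rw [Set.disjoint_left]
      rintro y ⟨hjx, hyj⟩ ⟨hkx, hyk⟩
      have hjK : j ∈ K := (Finset.mem_insert.1 hj).resolve_left hjx
      have hkK : k ∈ K := (Finset.mem_insert.1 hk).resolve_left hkx
      rcases hyj with hyj | hyj <;> rcases hyk with hyk | hyk
      · exact Set.disjoint_left.1 (h2 j hjK k hkK hjk) hyj hyk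
      · exact (h1 j hjK y hyj).2 k (hK hkK) hyk
      · exact (h1 k hkK y hyk).2 j (hK hjK) hyj
      · obtain ⟨w, hw, -, hkw⟩ := hc k (hK₀ (hK hkK))
        rw [hyk, Option.some_inj] at hw
        exact hK₀R j (hK hjK) k (hK hkK) hjk ⟨y, hyj, hw ▸ hkw⟩
    · have hedge : ∀ j ∈ K, ∃ y, (j ≠ x ∧ (y ∈ Z j ∨ c j = some y)) ∧ E x y := by
        intro j hj
        obtain ⟨w, hw, hxw, -⟩ := hc j (hK₀ (hK hj))
        exact ⟨w, ⟨hxK j hj, Or.inr hw⟩, hxw⟩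
      intro j hj k hk hjk
      rcases Finset.mem_insert.1 hj with hj | hj <;> rcases Finset.mem_insert.1 hk with hk | hk
      · exact absurd (hj.trans hk.symm) hjk
      · exact Or.inr (hj ▸ hedge k hk)
      · exact Or.inl (hk ▸ hedge j hj)
      · exact (h3 j hj k hk hjk).imp
          (fun ⟨y, hy, h⟩ => ⟨y, ⟨hxK j hj, Or.inl hy⟩, h.1⟩)
          fun ⟨y, hy, h⟩ => ⟨y, ⟨hxK k hk, Or.inl hy⟩, h.1⟩

/-- A complete bipartite graph contains a star model. -/
theorem hasStarModel_of_complete {I Y : Type*} {E : I → Y → Prop} {J : Finset I} (S : Finset Y)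
    (hE : ∀ i ∈ J, ∀ y ∈ S, E i y) (hJ : S.card ≤ J.card) : HasStarModel E J S.card := by
  classical
  obtain ⟨K, hK, hcard⟩ := Finset.exists_subset_card_eq hJ
  let e := Finset.equivOfCardEq hcard
  refine ⟨K, hK, hcard, fun j => {y | ∃ h : j ∈ K, y = e ⟨j, h⟩}, ?_, ?_, ?_⟩
  · rintro j hj y ⟨h, rfl⟩
    exact hE j (hK hj) _ (e _).2
  · intro j hj k hk hjk
    rw [Set.disjoint_left]
    rintro y ⟨h, rfl⟩ ⟨h', hy⟩
    have := e.injective (Subtype.ext hy)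
    exact hjk (congrArg Subtype.val this)
  · intro j hj k hk hjk
    exact Or.inl ⟨_, ⟨hj, rfl⟩, hE k (hK hk) _ (e _).2⟩

/-- The number of vertices on the left needed in `exists_sparse_or_hasStarModel`. -/
def sparseBound (t m k : ℕ) : ℕ := (fun M => 2 ^ (starBound M t + m))^[k] t

/-- Grow a set `S` of right vertices complete to `J`, with `k` vertices still missing. Apply Ramsey
to having a common neighbour outside `S`. An independent set is the sparse outcome. In a clique,
either some vertex outside `S` has large degree and joins `S`, or degrees are bounded and
`hasStarModel_of_degree_le` applies. At `k = 0` the complete bipartite graph is itself enough. -/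
theorem exists_sparse_or_hasStarModel_aux {I Y : Type*} {E : I → Y → Prop} {t m k : ℕ}
    {J : Finset I} {S : Finset Y} (hS : S.card + k = t) (hE : ∀ i ∈ J, ∀ y ∈ S, E i y)
    (hJ : sparseBound t m k ≤ J.card) :
    (∃ S : Finset Y, S.card ≤ t ∧ ∃ K ⊆ J, K.card = m ∧
      ∀ i ∈ K, ∀ j ∈ K, i ≠ j → ∀ y, E i y → E j y → y ∈ S) ∨ HasStarModel E J t := by
  classical
  induction k generalizing J S with
  | zero =>
    have hS' : S.card = t := hS
    exact Or.inr (hS' ▸ hasStarModel_of_complete S hE (hS'.symm ▸ hJ))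
  | succ k ih =>
    rw [sparseBound, Function.iterate_succ_apply', ← sparseBound] at hJ
    obtain ⟨C, hC, hcard, hCR⟩ | ⟨K, hK, hcard, hKR⟩ := Finset.exists_homogeneous
      (R := fun i j => ∃ y, (E i y ∧ y ∉ S) ∧ E j y ∧ y ∉ S)
      (fun i j ⟨y, h1, h2⟩ => ⟨y, h2, h1⟩) _ _ J hJ
    · by_cases hy : ∃ y, y ∉ S ∧ sparseBound t m k ≤ (C.filter (E · y)).card
      · obtain ⟨y, hyS, hy⟩ := hy
        have hsub : C.filter (E · y) ⊆ J := (Finset.filter_subset _ _).trans hC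
        obtain ⟨S', hS', K, hK, h⟩ | h := ih (J := C.filter (E · y)) (S := insert y S)
          (by rw [Finset.card_insert_of_notMem hyS]; omega)
          (by
            intro i hi z hz
            rcases Finset.mem_insert.1 hz with rfl | hz
            · exact (Finset.mem_filter.1 hi).2
            · exact hE i (hsub hi) z hz) hy
        · exact Or.inl ⟨S', hS', K, hK.trans hsub, h⟩
        · exact Or.inr (h.mono (fun _ _ => id) hsub)
      · push Not at hy
        refine Or.inr ((hasStarModel_of_degree_le (E := fun i y => E i y ∧ y ∉ S) (J := C)
          (D := sparseBound t m k) (fun y => ?_) hCR hcard.ge).mono (fun _ _ h => h.1) hC)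
        by_cases hyS : y ∈ S
        · simp [hyS]
        · simpa [hyS] using (hy y hyS).le
    · refine Or.inl ⟨S, by omega, K, hK, hcard, fun i hi j hj hij y h1 h2 => ?_⟩
      by_contra hyS
      exact hKR i hi j hj hij ⟨y, ⟨h1, hyS⟩, h2, hyS⟩

/-- In a bipartite graph with many vertices on the left, either there is a star model, or after
deleting few vertices on the right there are many vertices on the left without common
neighbours. -/
theorem exists_sparse_or_hasStarModel {I Y : Type*} (E : I → Y → Prop) {t m : ℕ}
    {J : Finset I} (hJ : sparseBound t m t ≤ J.card) :
    (∃ S : Finset Y, S.card ≤ t ∧ ∃ K ⊆ J, K.card = m ∧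
      ∀ i ∈ K, ∀ j ∈ K, i ≠ j → ∀ y, E i y → E j y → y ∈ S) ∨ HasStarModel E J t :=
  exists_sparse_or_hasStarModel_aux (S := ∅) (by simp) (by simp) hJ

/-! ### Uniform quasi-wideness -/

namespace SimpleGraph

variable {V I : Type*} {G : SimpleGraph V}

theorem Near.within_ball {U : Set V} {k : ℕ} {x y : V} (h : G.Near U k x y) :
    G.Near {z | G.Near U k x z} k x y := by
  induction k generalizing y with
  | zero => exact ⟨h.1, rfl, h.2⟩
  | succ k ih =>
    have hy := h
    obtain ⟨z, hz, hyU, hzy⟩ := h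
    exact ⟨z, (ih hz).mono_set fun w hw => Near.succ hw, hy, hzy⟩

theorem Near.edist_induce_le {X : Set V} {k : ℕ} {x y : V} (h : G.Near X k x y) :
    ((⊤ : G.Subgraph).induce X).coe.edist ⟨x, h.left_mem⟩ ⟨y, h.right_mem⟩ ≤ k := by
  induction k generalizing y with
  | zero =>
    obtain ⟨rfl, -⟩ := h
    simp
  | succ k ih =>
    obtain ⟨z, hz, hy, hzy⟩ := h
    rcases hzy with rfl | hzy
    · exact (ih hz).trans (by exact_mod_cast Nat.le_succ k)
    · refine (SimpleGraph.edist_triangle (v := ⟨z, hz.right_mem⟩)).trans ?_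
      have : ((⊤ : G.Subgraph).induce X).coe.edist ⟨z, hz.right_mem⟩ ⟨y, hy⟩ = 1 := by
        rw [edist_eq_one_iff_adj]
        exact ⟨hz.right_mem, hy, hzy⟩
      rw [this]
      push_cast
      exact add_le_add (ih hz) le_rfl

/-- A complete depth-`r` minor is given by disjoint, pairwise adjacent sets that lie within `r`
steps of their centres. -/
theorem isDepthMinor_top_of_sets {K : Finset I} {r t : ℕ} (hK : K.card = t) (X : I → Set V)
    (c : I → V) (hc : ∀ j ∈ K, c j ∈ X j) (hX : ∀ j ∈ K, ∀ y ∈ X j, G.Near (X j) r (c j) y)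
    (hdisj : ∀ j ∈ K, ∀ k ∈ K, j ≠ k → Disjoint (X j) (X k))
    (hadj : ∀ j ∈ K, ∀ k ∈ K, j ≠ k → ∃ x ∈ X j, ∃ y ∈ X k, G.Adj x y) :
    (⊤ : SimpleGraph (Fin t)).IsDepthMinor r G := by
  let e : Fin t ≃ K := (K.equivFinOfCardEq hK).symm
  have hne : ∀ w w' : Fin t, w ≠ w' → (e w : I) ≠ e w' := fun w w' h h' =>
    h (e.injective (Subtype.ext h'))
  have hecc : ∀ w, ((⊤ : G.Subgraph).induce (X (e w))).coe.eccent
      ⟨c (e w), hc _ (e w).2⟩ ≤ r := by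
    intro w
    rw [eccent_le_iff]
    rintro ⟨y, hy⟩
    exact (hX _ (e w).2 y hy).edist_induce_le
  refine ⟨fun w => (⊤ : G.Subgraph).induce (X (e w)), ⟨fun w => ?_, fun w w' h => ?_,
    fun w w' h => ?_⟩, fun w => ?_⟩
  · rw [Subgraph.connected_iff']
    -- A disconnected branch set would have infinite eccentricity at its centre.
    by_contra hcon
    have := hecc w
    rw [eccent_eq_top_of_not_connected hcon] at this
    exact absurd this (by simp)
  · exact hdisj _ (e w).2 _ (e w').2 (hne w w' h)
  · exact hadj _ (e w).2 _ (e w').2 (hne w w' h.ne)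
  · exact (iInf_le _ _).trans (hecc w)

theorem IsDepthMinor.mono {W : Type*} {H : SimpleGraph W} {r r' : ℕ} (h : H.IsDepthMinor r G)
    (hr : r ≤ r') : H.IsDepthMinor r' G := by
  obtain ⟨M, hM, hrad⟩ := h
  exact ⟨M, hM, fun w => (hrad w).trans (by exact_mod_cast hr)⟩

/-- The number of balls needed in `exists_disjoint_balls_succ`. -/
def ballBound (t m : ℕ) : ℕ := 2 ^ (t + sparseBound t m t)

/-- If many balls of radius `i` are disjoint, then after deleting few vertices many balls of
radius `i + 1` are disjoint. -/
theorem exists_disjoint_balls_succ {i t m : ℕ}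
    (hG : ¬ (⊤ : SimpleGraph (Fin t)).IsDepthMinor (i + 1) G) {x : I → V} {J : Finset I}
    {S : Finset V} (hxS : ∀ j ∈ J, x j ∉ S)
    (hball : ∀ j ∈ J, ∀ k ∈ J, j ≠ k → ∀ y,
      G.Near (S : Set V)ᶜ i (x j) y → ¬ G.Near (S : Set V)ᶜ i (x k) y)
    (hJ : ballBound t m ≤ J.card) :
    ∃ S' : Finset V, S'.card ≤ S.card + t ∧ ∃ K ⊆ J, K.card = m ∧ (∀ j ∈ K, x j ∉ S') ∧
      ∀ j ∈ K, ∀ k ∈ K, j ≠ k → ∀ y,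
        G.Near (S' : Set V)ᶜ (i + 1) (x j) y → ¬ G.Near (S' : Set V)ᶜ (i + 1) (x k) y := by
  classical
  set U : Set V := (S : Set V)ᶜ with hU
  obtain ⟨K, hK, hcard, hKR⟩ | ⟨J', hJ', hcard, hind⟩ := Finset.exists_homogeneous
    (R := fun j k => ∃ y, G.Near U i (x j) y ∧ ∃ z, G.Near U i (x k) z ∧ G.Adj y z)
    (fun j k ⟨y, hy, z, hz, h⟩ => ⟨z, hz, y, hy, h.symm⟩) _ _ J hJ
  · exfalso
    refine hG (IsDepthMinor.mono (isDepthMinor_top_of_sets (r := i) hcard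
      (fun j => {z | G.Near U i (x j) z}) x (fun j hj => Near.refl (hxS j (hK hj)))
      (fun j _ y hy => Near.within_ball hy) (fun j hj k hk hjk => ?_)
      fun j hj k hk hjk => ?_) i.le_succ)
    · exact Set.disjoint_left.2 fun y => hball j (hK hj) k (hK hk) hjk y
    · obtain ⟨y, hy, z, hz, h⟩ := hKR j hj k hk hjk
      exact ⟨y, hy, z, hz, h⟩
  -- Contract each ball to its index and join it to the next layer. No edges run between the
  -- remaining balls, so these layers miss all balls, and a star model expands to a K_t minor of
  -- depth i + 1.
  let E : I → V → Prop := fun j y => y ∈ U ∧ ¬ G.Near U i (x j) y ∧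
    ∃ z, G.Near U i (x j) z ∧ G.Adj z y
  have hE : ∀ j ∈ J', ∀ k ∈ J', ∀ y, E j y → ¬ G.Near U i (x k) y := by
    rintro j hj k hk y ⟨-, hy, z, hz, hzy⟩ hky
    by_cases hjk : j = k
    · exact hy (hjk ▸ hky)
    · exact hind j hj k hk hjk ⟨z, hz, y, hky, hzy⟩
  obtain ⟨S₀, hS₀, K, hK, hKcard, hKE⟩ | ⟨K, hK, hKcard, Z, h1, h2, h3⟩ :=
    exists_sparse_or_hasStarModel E (t := t) (m := m) (J := J') hcard.ge
  -- Centres must survive the deletion. Sparing them is harmless, because a vertex shared by two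
  -- layers lies in no ball and so is no centre.
  · let S₁ := S₀.filter fun y => ∀ k ∈ K, y ≠ x k
    have hUsub : ((S ∪ S₁ : Finset V) : Set V)ᶜ ⊆ U := by
      rw [hU, Set.compl_subset_compl]
      exact_mod_cast Finset.subset_union_left
    refine ⟨S ∪ S₁, ?_, K, hK.trans hJ', hKcard, ?_, ?_⟩
    · exact (Finset.card_union_le _ _).trans
        (Nat.add_le_add_left ((Finset.card_filter_le _ _).trans hS₀) _)
    · intro j hj hjS
      rcases Finset.mem_union.1 hjS with h | h
      · exact hxS j (hJ' (hK hj)) h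
      · exact (Finset.mem_filter.1 h).2 j hj rfl
    · intro j hj k hk hjk y hy hy'
      have hcase : ∀ l, G.Near ((S ∪ S₁ : Finset V) : Set V)ᶜ (i + 1) (x l) y →
          G.Near U i (x l) y ∨ E l y := by
        intro l hl
        by_cases hn : G.Near U i (x l) y
        · exact Or.inl hn
        · obtain ⟨z, hz, hyU, hzy⟩ := hl
          have hz' := hz.mono_set hUsub
          exact Or.inr ⟨hUsub hyU, hn, z, hz', hzy.resolve_left fun h => hn (h ▸ hz')⟩
      rcases hcase j hy with h1 | h1 <;> rcases hcase k hy' with h2 | h2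
      · exact hball j (hJ' (hK hj)) k (hJ' (hK hk)) hjk y h1 h2
      · exact hE k (hK hk) j (hK hj) y h2 h1
      · exact hE j (hK hj) k (hK hk) y h1 h2
      · refine hy.right_mem (Finset.mem_coe.2 (Finset.mem_union_right _ (Finset.mem_filter.2
          ⟨hKE j hj k hk hjk y h1 h2, fun l hl hyl => hE j (hK hj) l (hK hl) y h1 ?_⟩)))
        rw [hyl]
        exact Near.refl (hxS l (hJ' (hK hl)))
  · exfalso
    refine hG (isDepthMinor_top_of_sets hKcard (fun j => {z | G.Near U i (x j) z} ∪ Z j) x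
      (fun j hj => Or.inl (Near.refl (hxS j (hJ' (hK hj))))) ?_ ?_ ?_)
    · rintro j hj y (hy | hy)
      · exact (hy.within_ball.mono_set Set.subset_union_left).succ
      · obtain ⟨-, -, z, hz, hzy⟩ := h1 j hj y hy
        exact ⟨z, hz.within_ball.mono_set Set.subset_union_left, Or.inr hy, Or.inr hzy⟩
    · intro j hj k hk hjk
      rw [Set.disjoint_left]
      rintro y (hyj | hyj) (hyk | hyk)
      · exact hball j (hJ' (hK hj)) k (hJ' (hK hk)) hjk y hyj hyk
      · exact hE k (hK hk) j (hK hj) y (h1 k hk y hyk) hyj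
      · exact hE j (hK hj) k (hK hk) y (h1 j hj y hyj) hyk
      · exact Set.disjoint_left.1 (h2 j hj k hk hjk) hyj hyk
    · intro j hj k hk hjk
      obtain ⟨y, hy, -, -, z, hz, hzy⟩ | ⟨y, hy, -, -, z, hz, hzy⟩ := h3 j hj k hk hjk
      · exact ⟨y, Or.inr hy, z, Or.inl hz, hzy.symm⟩
      · exact ⟨z, Or.inl hz, y, Or.inr hy, hzy⟩

/-- Balls of radius 0 are disjoint by injectivity; each growth step deletes at most `t` vertices. -/
theorem exists_disjoint_balls {r t : ℕ} (hG : ¬ (⊤ : SimpleGraph (Fin t)).IsDepthMinor r G)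
    {x : I → V} {i m : ℕ} (hi : i ≤ r) {J : Finset I} (hx : Set.InjOn x J)
    (hJ : (ballBound t)^[i] m ≤ J.card) :
    ∃ S : Finset V, S.card ≤ i * t ∧ ∃ K ⊆ J, K.card = m ∧ (∀ j ∈ K, x j ∉ S) ∧
      ∀ j ∈ K, ∀ k ∈ K, j ≠ k → ∀ y,
        G.Near (S : Set V)ᶜ i (x j) y → ¬ G.Near (S : Set V)ᶜ i (x k) y := by
  induction i generalizing m with
  | zero =>
    obtain ⟨K, hK, hcard⟩ := Finset.exists_subset_card_eq hJ
    refine ⟨∅, by simp, K, hK, hcard, by simp, fun j hj k hk hjk y hy hy' => hjk ?_⟩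
    exact hx (hK hj) (hK hk) (hy.1.trans hy'.1.symm)
  | succ i ih =>
    obtain ⟨S, hS, K, hK, hcard, hxS, hball⟩ := ih (m := ballBound t m) (by omega) hJ
    obtain ⟨S', hS', K', hK', h⟩ := exists_disjoint_balls_succ
      (fun h => hG (h.mono hi)) hxS hball hcard.ge
    have : (i + 1) * t = i * t + t := by ring
    exact ⟨S', by omega, K', hK'.trans hK, h⟩

/-- The number of vertices needed in `exists_scattered`. -/
def scatterBound (t r m : ℕ) : ℕ := 2 ^ (m + (ballBound t)^[r] m)

/-- Uniform quasi-wideness: in a graph without `K_t` as a depth-`r` minor, among many vertices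
there are many that are pairwise far from each other after the deletion of few vertices. -/
theorem exists_scattered {r t : ℕ} (hG : ¬ (⊤ : SimpleGraph (Fin t)).IsDepthMinor r G)
    (x : I → V) {m : ℕ} {J : Finset I} (hJ : scatterBound t r m ≤ J.card) :
    ∃ S : Finset V, S.card ≤ r * t + 1 ∧ ∃ K ⊆ J, K.card = m ∧
      ∀ j ∈ K, ∀ k ∈ K, j ≠ k → ¬ G.Near (S : Set V)ᶜ (2 * r) (x j) (x k) := by
  obtain ⟨K, hK, hcard, hKx⟩ | ⟨K, hK, hcard, hKx⟩ := Finset.exists_homogeneous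
    (R := fun j k => x j = x k) (fun _ _ => Eq.symm) _ _ J hJ
  · rcases K.eq_empty_or_nonempty with rfl | ⟨l, hl⟩
    · exact ⟨∅, by simp, ∅, hK, hcard, by simp⟩
    -- On a constant family, deleting its only value makes `Near` fail outright.
    · refine ⟨{x l}, by simp, K, hK, hcard, fun j hj k hk hjk hn => hn.left_mem ?_⟩
      by_cases hjl : j = l
      · simp [hjl]
      · simp [hKx j hj l hl hjl]
  · obtain ⟨S, hS, K', hK', hcard', hxS, hball⟩ := exists_disjoint_balls hG le_rfl (x := x) (J := K)
      (fun j hj k hk hjk => by_contra fun hne => hKx j hj k hk hne hjk) hcard.ge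
    refine ⟨S, by omega, K', hK'.trans hK, hcard', fun j hj k hk hjk hn => ?_⟩
    rw [two_mul] at hn
    obtain ⟨z, hz, hz'⟩ := hn.exists_of_add
    exact hball j hj k hk hjk z hz hz'.symm

theorem exists_scattered_coordinates {r t : ℕ}
    (hG : ¬ (⊤ : SimpleGraph (Fin t)).IsDepthMinor r G) {ι : Type*} (x : ι → I → V) (A : Finset ι)
    {m : ℕ} {J : Finset I} (hJ : (scatterBound t r)^[A.card] m ≤ J.card) :
    ∃ S : Finset V, S.card ≤ A.card * (r * t + 1) ∧ ∃ K ⊆ J, K.card = m ∧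
      ∀ a ∈ A, ∀ j ∈ K, ∀ k ∈ K, j ≠ k →
        ¬ G.Near (S : Set V)ᶜ (2 * r) (x a j) (x a k) := by
  classical
  induction A using Finset.induction_on generalizing J with
  | empty =>
    obtain ⟨K, hK, hcard⟩ := Finset.exists_subset_card_eq hJ
    exact ⟨∅, by simp, K, hK, hcard, by simp⟩
  | insert a A ha ih =>
    rw [Finset.card_insert_of_notMem ha, Function.iterate_succ_apply'] at hJ
    obtain ⟨S₁, hS₁, K₁, hK₁, hcard₁, h₁⟩ := exists_scattered hG (x a) hJ
    obtain ⟨S₂, hS₂, K₂, hK₂, hcard₂, h₂⟩ := ih hcard₁.ge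
    have hmono₁ : ((S₁ ∪ S₂ : Finset V) : Set V)ᶜ ⊆ (S₁ : Set V)ᶜ :=
      Set.compl_subset_compl.2 (by exact_mod_cast Finset.subset_union_left)
    have hmono₂ : ((S₁ ∪ S₂ : Finset V) : Set V)ᶜ ⊆ (S₂ : Set V)ᶜ :=
      Set.compl_subset_compl.2 (by exact_mod_cast Finset.subset_union_right)
    refine ⟨S₁ ∪ S₂, ?_, K₂, hK₂.trans hK₁, hcard₂, ?_⟩
    · have := Finset.card_union_le S₁ S₂
      rw [Finset.card_insert_of_notMem ha, add_mul, one_mul]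
      omega
    · intro b hb j hj k hk hjk hn
      rcases Finset.mem_insert.1 hb with rfl | hb
      · exact h₁ j (hK₂ hj) k (hK₂ hk) hjk (hn.mono_set hmono₁)
      · exact h₂ b hb j hj k hk hjk (hn.mono_set hmono₂)

/-- The number of tuples of length `d` needed in `exists_scattered_tuples`. -/
def tupleBound (t r d m : ℕ) : ℕ := (scatterBound t r)^[d] (m * (2 * (d * d) + 1))

/-- Uniform quasi-wideness for tuples. -/
theorem exists_scattered_tuples {r t : ℕ}
    (hG : ¬ (⊤ : SimpleGraph (Fin t)).IsDepthMinor r G) {ι : Type*} [Fintype ι] (x : ι → I → V)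
    {m : ℕ} {J : Finset I} (hJ : tupleBound t r (Fintype.card ι) m ≤ J.card) :
    ∃ S : Finset V, S.card ≤ Fintype.card ι * (r * t + 1) ∧ ∃ K ⊆ J, K.card = m ∧
      ∀ a b, ∀ j ∈ K, ∀ k ∈ K, j ≠ k → ¬ G.Near (S : Set V)ᶜ r (x a j) (x b k) := by
  classical
  obtain ⟨S, hS, K, hK, hcard, h⟩ := exists_scattered_coordinates hG x Finset.univ hJ
  -- For fixed `j`, `a`, `b` at most one `k` has `x b k` within `r` of `x a j`, since two would be
  -- within `2 * r` of each other. So the out-degree is at most the number of pairs (a, b).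
  obtain ⟨K', hK', hcard', h'⟩ := Finset.exists_independent_of_outDegree_le
    (R := fun j k => ∃ a b, G.Near (S : Set V)ᶜ r (x a j) (x b k))
    (D := Fintype.card ι * Fintype.card ι) m K (by
      intro j hj
      rw [← Fintype.card_prod, ← Finset.card_univ]
      refine Finset.card_le_card_of_forall_subsingleton
        (fun k p => G.Near (S : Set V)ᶜ r (x p.1 j) (x p.2 k)) (fun k hk => ?_) fun p _ => ?_
      · obtain ⟨-, a, b, hab⟩ := Finset.mem_filter.1 hk
        exact ⟨(a, b), Finset.mem_univ _, hab⟩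
      · rintro k ⟨hk, hn⟩ l ⟨hl, hn'⟩
        by_contra hkl
        refine h p.2 (Finset.mem_univ _) k (Finset.mem_filter.1 hk).1 l (Finset.mem_filter.1 hl).1
          hkl ?_
        rw [two_mul]
        exact hn.symm.trans hn') hcard.ge
  exact ⟨S, hS, K', hK'.trans hK, hcard', fun a b j hj k hk hjk hn => h' j hj k hk hjk ⟨a, b, hn⟩⟩

end SimpleGraph

/-! ### Bounding the length of ladders -/

namespace SimpleGraph

open Language

variable {V : Type*} {G : SimpleGraph V}

/-- The bound for the size of the set that separates the tuples of a ladder. -/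
def separatorBound (q d t : ℕ) : ℕ := d * (4 ^ q * t + 1)

/-- The rank of the types that are compared in a ladder. -/
def ladderRank (q d t : ℕ) : ℕ := partRank (separatorBound q d t + d + q) q

/-- The bound for the ladder index. -/
def ladderBound (q d t : ℕ) : ℕ :=
  tupleBound t (4 ^ q) d
    (gameTypeBound (separatorBound q d t + d + ladderRank q d t) (ladderRank q d t) + 1)

/-- If the tuples of two rungs of a ladder have the same type over `S` and are far from each other
outside `S`, then the right tuples of the two rungs can be exchanged. -/
theorem realize_iff_of_gameType_eq [Finite V] {q a b D : ℕ} {S : Finset V}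
    {φ : Language.graph.Formula (Fin a ⊕ Fin b)} (hφ : φ.quantifierRank ≤ q)
    (hD : S.card + (a + b) + q ≤ D) {u u' : Fin a → V} {v v' : Fin b → V}
    (htp : G.gameType (partRank D q) (Sum.elim (Subtype.val : S → V) (Sum.elim u v)) =
      G.gameType (partRank D q) (Sum.elim (Subtype.val : S → V) (Sum.elim u' v')))
    (hfar : ∀ i j, ¬ G.Near (S : Set V)ᶜ (4 ^ q) (u i) (v' j))
    (hfar' : ∀ i j, ¬ G.Near (S : Set V)ᶜ (4 ^ q) (u' i) (v j)) :
    letI := G.structure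
    φ.Realize (Sum.elim u v') ↔ φ.Realize (Sum.elim u' v) := by
  let A : Set (V × V) := Set.range fun o : S ⊕ Fin a =>
    (Sum.elim (Subtype.val : S → V) u o, Sum.elim (Subtype.val : S → V) u' o)
  -- `B` runs from the second rung to the first, against the direction of `A`, so that the union
  -- sends (u, v') to (u', v).
  let B : Set (V × V) := Set.range fun o : S ⊕ Fin b =>
    (Sum.elim (Subtype.val : S → V) v' o, Sum.elim (Subtype.val : S → V) v o)
  have hbf := backForth_of_gameType_eq htp
  have hA : G.BackForth (partRank D q) A := by
    refine hbf.mono ?_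
    rintro _ ⟨s | i, rfl⟩
    · exact ⟨Sum.inl s, rfl⟩
    · exact ⟨Sum.inr (Sum.inl i), rfl⟩
  have hB : G.BackForth (partRank D q) B := by
    refine hbf.swap.mono ?_
    rintro _ ⟨s | i, rfl⟩
    · exact ⟨Sum.inl s, rfl⟩
    · exact ⟨Sum.inr (Sum.inr i), rfl⟩
  have hcard : ∀ {n : ℕ} (f : S ⊕ Fin n → V × V), (Set.range f).ncard ≤ S.card + n := by
    intro n f
    rw [← Set.image_univ]
    refine (Set.ncard_image_le (Set.toFinite _)).trans ?_
    rw [Set.ncard_univ, Nat.card_sum]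
    simp
  have hAB : ∀ e ∈ A, ∀ e' ∈ B, ¬ G.Near (S : Set V)ᶜ (4 ^ q) e.1 e'.1 ∧
      ¬ G.Near (S : Set V)ᶜ (4 ^ q) e.2 e'.2 := by
    rintro _ ⟨s | i, rfl⟩ _ ⟨s' | j, rfl⟩
    · exact ⟨fun hn => hn.left_mem s.2, fun hn => hn.left_mem s.2⟩
    · exact ⟨fun hn => hn.left_mem s.2, fun hn => hn.left_mem s.2⟩
    · exact ⟨fun hn => hn.right_mem s'.2, fun hn => hn.right_mem s'.2⟩
    · exact ⟨hfar i j, hfar' i j⟩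
  have hsplit : G.IsSplitPosition (S : Set V) D q fun o : Bool => bif o then A else B := by
    refine ⟨?_, ?_, ?_, ?_⟩
    · rintro (_ | _) s hs
      · exact ⟨Sum.inl ⟨s, hs⟩, rfl⟩
      · exact ⟨Sum.inl ⟨s, hs⟩, rfl⟩
    · rintro (_ | _)
      · have h1 : B.ncard ≤ S.card + b := hcard _
        simp only [cond_false]
        omega
      · have h1 : A.ncard ≤ S.card + a := hcard _
        simp only [cond_true]
        omega
    · rintro (_ | _)
      exacts [hB, hA]
    · rintro (_ | _) (_ | _) hne e he e' he'
      · exact absurd rfl hne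
      · have := hAB e' he' e he
        exact ⟨fun hn => this.1 hn.symm, fun hn => this.2 hn.symm⟩
      · exact hAB e he e' he'
      · exact absurd rfl hne
  have hwin := hsplit.backForth_iUnion (by rw [Set.ncard_coe_finset]; omega)
  refine hwin.realize_iff φ hφ (fun i => ?_) fun i => i.elim0
  rcases i with i | i
  · exact Set.mem_iUnion.2 ⟨true, Sum.inr i, rfl⟩
  · exact Set.mem_iUnion.2 ⟨false, Sum.inr i, rfl⟩

/-- Among the mutually far rungs there is one more than there are types over `S`, so two rungs share
a type and can be exchanged. -/
theorem ladderIndex_le [Finite V] {q t a b : ℕ} {φ : Language.graph.Formula (Fin a ⊕ Fin b)}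
    (hφ : φ.quantifierRank ≤ q) (hG : ¬ (⊤ : SimpleGraph (Fin t)).IsDepthMinor (4 ^ q) G) :
    letI := G.structure
    ladderIndex V φ ≤ (ladderBound q (a + b) t : ℕ∞) := by
  let := G.structure
  refine sInf_le ⟨_, rfl, ?_⟩
  rintro ⟨u, v, h⟩
  have hd : Fintype.card (Fin a ⊕ Fin b) = a + b := by simp
  obtain ⟨S, hS, K, -, hK, hfar⟩ := exists_scattered_tuples hG (ι := Fin a ⊕ Fin b)
    (fun o i => Sum.elim (u i) (v i) o) (J := Finset.univ)
    (m := gameTypeBound (separatorBound q (a + b) t + (a + b) + ladderRank q (a + b) t)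
      (ladderRank q (a + b) t) + 1) (by rw [hd, Finset.card_univ, Fintype.card_fin, ladderBound])
  rw [hd] at hS
  obtain ⟨hfin, hle⟩ := card_gameType_le
    (M := separatorBound q (a + b) t + (a + b) + ladderRank q (a + b) t)
    (p := ladderRank q (a + b) t) (ι := S ⊕ (Fin a ⊕ Fin b)) (by
      rw [Nat.card_sum, Nat.card_eq_fintype_card (α := Fin a ⊕ Fin b), hd]
      simp only [Nat.card_eq_fintype_card, Fintype.card_coe]
      unfold separatorBound
      omega)
  have := Fintype.ofFinite (GameType (ladderRank q (a + b) t) (S ⊕ (Fin a ⊕ Fin b)))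
  obtain ⟨i, hi, j, hj, hij, htp⟩ := Finset.exists_ne_map_eq_of_card_lt_of_maps_to
    (s := K) (t := (Finset.univ : Finset (GameType (ladderRank q (a + b) t)
      (S ⊕ (Fin a ⊕ Fin b)))))
    (f := fun i => G.gameType (ladderRank q (a + b) t)
      (Sum.elim (Subtype.val : S → V) (Sum.elim (u i) (v i))))
    (by rw [Finset.card_univ, ← Nat.card_eq_fintype_card, hK]; omega) (fun _ _ => Finset.mem_univ _)
  have key : ∀ i ∈ K, ∀ j ∈ K, G.gameType (ladderRank q (a + b) t)
      (Sum.elim (Subtype.val : S → V) (Sum.elim (u i) (v i))) =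
      G.gameType (ladderRank q (a + b) t)
      (Sum.elim (Subtype.val : S → V) (Sum.elim (u j) (v j))) → ¬ i < j := by
    intro i hi j hj htp hlt
    have hiff := realize_iff_of_gameType_eq (φ := φ) hφ
      (D := separatorBound q (a + b) t + (a + b) + q) (by unfold separatorBound; omega) htp
      (fun k l => hfar (Sum.inl k) (Sum.inr l) i hi j hj hlt.ne)
      (fun k l => hfar (Sum.inl k) (Sum.inr l) j hj i hi hlt.ne')
    exact absurd ((h j i).1 (hiff.1 ((h i j).2 hlt.le))) (not_le.2 hlt)
  rcases lt_or_gt_of_ne hij with hlt | hlt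
  · exact key i hi j hj htp hlt
  · exact key j hj i hi htp.symm hlt

end SimpleGraph

/-! ### Primitive recursiveness of the bounds -/

theorem Primrec.nat_pow : Primrec₂ ((· ^ ·) : ℕ → ℕ → ℕ) :=
  (Primrec.nat_iterate Primrec.snd (Primrec.const 1)
    (Primrec.nat_mul.comp (Primrec.fst.comp Primrec.fst) Primrec.snd).to₂).of_eq fun p => by
      simp [mul_left_iterate]

section Primrec

variable {α : Type*} [Primcodable α] {f₁ f₂ f₃ f₄ : α → ℕ}

theorem primrec_starBound (h₁ : Primrec f₁) (h₂ : Primrec f₂) :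
    Primrec fun x => starBound (f₁ x) (f₂ x) := by
  refine Primrec.nat_iterate h₂ (Primrec.const 0)
    (h := fun x N => N * (2 * f₁ x + 1) + 1) ?_
  exact Primrec.succ.comp (Primrec.nat_mul.comp Primrec.snd (Primrec.nat_double_succ.comp
    (h₁.comp Primrec.fst)))

theorem primrec_sparseBound (h₁ : Primrec f₁) (h₂ : Primrec f₂) (h₃ : Primrec f₃) :
    Primrec fun x => sparseBound (f₁ x) (f₂ x) (f₃ x) := by
  refine Primrec.nat_iterate h₃ h₁
    (h := fun x M => 2 ^ (starBound M (f₁ x) + f₂ x)) ?_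
  exact Primrec.nat_pow.comp (Primrec.const 2) (Primrec.nat_add.comp
    (primrec_starBound Primrec.snd (h₁.comp Primrec.fst)) (h₂.comp Primrec.fst))

open SimpleGraph

theorem primrec_ballBound (h₁ : Primrec f₁) (h₂ : Primrec f₂) :
    Primrec fun x => ballBound (f₁ x) (f₂ x) :=
  Primrec.nat_pow.comp (Primrec.const 2) (Primrec.nat_add.comp h₁ (primrec_sparseBound h₁ h₂ h₁))

theorem primrec_scatterBound (h₁ : Primrec f₁) (h₂ : Primrec f₂) (h₃ : Primrec f₃) :
    Primrec fun x => scatterBound (f₁ x) (f₂ x) (f₃ x) := by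
  refine Primrec.nat_pow.comp (Primrec.const 2) (Primrec.nat_add.comp h₃ ?_)
  exact Primrec.nat_iterate h₂ h₃ (h := fun x m => ballBound (f₁ x) m)
    (primrec_ballBound (h₁.comp Primrec.fst) Primrec.snd).to₂

theorem primrec_tupleBound (h₁ : Primrec f₁) (h₂ : Primrec f₂) (h₃ : Primrec f₃)
    (h₄ : Primrec f₄) : Primrec fun x => tupleBound (f₁ x) (f₂ x) (f₃ x) (f₄ x) := by
  refine Primrec.nat_iterate h₃ (h := fun x m => scatterBound (f₁ x) (f₂ x) m) ?_
    (primrec_scatterBound (h₁.comp Primrec.fst) (h₂.comp Primrec.fst) Primrec.snd).to₂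
  exact Primrec.nat_mul.comp h₄ (Primrec.nat_double_succ.comp (Primrec.nat_mul.comp h₃ h₃))

theorem primrec_gameTypeBound (h₁ : Primrec f₁) (h₂ : Primrec f₂) :
    Primrec fun x => gameTypeBound (f₁ x) (f₂ x) := by
  have h : Primrec fun x => 4 ^ (f₁ x * f₁ x) :=
    Primrec.nat_pow.comp (Primrec.const 4) (Primrec.nat_mul.comp h₁ h₁)
  exact Primrec.nat_iterate h₂ h (h := fun x m => 4 ^ (f₁ x * f₁ x) * 2 ^ m)
    (Primrec.nat_mul.comp (h.comp Primrec.fst)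
      (Primrec.nat_pow.comp (Primrec.const 2) Primrec.snd)).to₂

theorem primrec_separatorBound (h₁ : Primrec f₁) (h₂ : Primrec f₂) (h₃ : Primrec f₃) :
    Primrec fun x => separatorBound (f₁ x) (f₂ x) (f₃ x) :=
  Primrec.nat_mul.comp h₂ (Primrec.succ.comp (Primrec.nat_mul.comp
    (Primrec.nat_pow.comp (Primrec.const 4) h₁) h₃))

theorem primrec_ladderRank (h₁ : Primrec f₁) (h₂ : Primrec f₂) (h₃ : Primrec f₃) :
    Primrec fun x => ladderRank (f₁ x) (f₂ x) (f₃ x) :=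
  Primrec.nat_add.comp
    (Primrec.nat_mul.comp h₁ (Primrec.succ.comp (Primrec.nat_add.comp
      (Primrec.nat_add.comp (primrec_separatorBound h₁ h₂ h₃) h₂) h₁)))
    (Primrec.nat_pow.comp (Primrec.const 4) (Primrec.succ.comp h₁))

theorem primrec_ladderBound (h₁ : Primrec f₁) (h₂ : Primrec f₂) (h₃ : Primrec f₃) :
    Primrec fun x => ladderBound (f₁ x) (f₂ x) (f₃ x) := by
  have hr := primrec_ladderRank h₁ h₂ h₃
  exact primrec_tupleBound h₃ (Primrec.nat_pow.comp (Primrec.const 4) h₁) h₂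
    (Primrec.succ.comp (primrec_gameTypeBound (Primrec.nat_add.comp
      (Primrec.nat_add.comp (primrec_separatorBound h₁ h₂ h₃) h₂) hr) hr))

end Primrec

theorem mainTheorem2 :
    ∃ (f : ℕ × ℕ × ℕ → ℕ) (g : ℕ → ℕ), Computable f ∧ Computable g ∧
      ∀ (q d t a b : ℕ) (φ : Language.graph.Formula (Fin a ⊕ Fin b)),
        φ.quantifierRank ≤ q → a + b = d →
        ∀ (V : Type*) [Finite V] (G : SimpleGraph V),
          ¬ (⊤ : SimpleGraph (Fin t)).IsDepthMinor (g q) G →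
          letI := G.structure
          Language.ladderIndex V φ ≤ (f (q, d, t) : ℕ∞) := by
  -- The depth 4^q is the separation that a split position needs for `q` rounds.
  refine ⟨fun x => SimpleGraph.ladderBound x.1 x.2.1 x.2.2, fun q => 4 ^ q,
    (primrec_ladderBound Primrec.fst (Primrec.fst.comp Primrec.snd)
      (Primrec.snd.comp Primrec.snd)).to_comp,
    (Primrec.nat_pow.comp (Primrec.const 4) Primrec.id).to_comp, ?_⟩
  rintro q _ t a b φ hφ rfl V _ G hG
  exact SimpleGraph.ladderIndex_le hφ hG
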